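/- **Setting.** Let $\mathcal C$ be the unit circle in $\mathbb R^2=\mathbb C$, $d(x,y)=|\underline x-\underline y|\wedge(2\pi-|\underline x-\underline y|)$ its geodesic distance ($\underline x\in[0,2\pi)$ being the argument of $x$), $\mathcal O$ the orthogonal group of $\mathbb R^2$, $d_\infty(\mathbf x,\mathbf y)=\max_i d(x_i,y_i)$ and $Q\mathbf x=(Qx_i)_i$ for tuples. Let $\mathcal C_k=\{e^{2\pi\iota l/k}:0\le l<k\}$; for a set $T$ of $k$ indices let $\boldsymbol\Pi_T$ be the set of tuples $(x_i)_{i\in T}$ that take each value of $\mathcal C_k$ exactly once. Put $\boldsymbol\Pi_n=\boldsymbol\Pi_{\{1,\dots,n\}}$ and $d_\infty(\mathbf x,\boldsymbol\Pi_n)=\min_{\mathbf y\in\boldsymbol\Pi_n}d_\infty(\mathbf x,\mathbf y)$. For $c_e\ge0$, $0<c_l\le c_L$ and $\varepsilon_n=c_e\sqrt{\log(n)/n}$, let $\mathcal{BL}[c_l,c_L,c_e]$ be the set of symmetric functions $f:\mathcal C^2\to[0,1]$ such that, for all $x,y,y'\in\mathcal C$, $|f(x,y)-f(x,y')|\le c_Ld(y,y')+\varepsilon_n$,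 and $f(x,y')-f(x,y)\ge c_l(d(x,y)-d(x,y'))-\varepsilon_n$ whenever $d(x,y)\ge d(x,y')$. For $F\in\mathbb R^{n\times n}$ let $\mathcal R[F,c_l,c_L,c_e]$ be the set of $(\mathbf x,f)\in\mathcal C^n\times\mathcal{BL}[c_l,c_L,c_e]$ with $f(x_i,x_j)=F_{ij}$ for all $i<j$. **Data.** Let $n=4n_0$ with $n_0\ge1$. Let $A\in\mathbb R^{n\times n}$ be a random symmetric matrix with zero diagonal and integrable entries, $F=\mathbb E[A]$, $E=A-F$, and assume that $F_{ij}=f^*(x^*_i,x^*_j)$ for $i<j$, for some $\mathbf x^*\in\mathcal C^n$ and $f^*\in\mathcal{BL}[c_l,c_L,c_e]$. Assume that the entries $E_{ij}$, $i<j$, are independent and that, for all $B\in\mathbb R^{n\times n}$ and $t\ge0$, $$\mathbb P\Big[\sum_{i<j}B_{ij}E_{ij}>t\Big(\sum_{i<j}B_{ij}^2\Big)^{1/2}\Big]\le e^{-t^2/2}.$$ **Estimator.** Independently of $A$, draw $S$ uniformly among the subsets of $\{1,\dots,n\}$ of size $n_0$ and then, given $S$, draw $S'$ uniformly among the subsets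 of $\overline S$ of size $n_0$ (bars denote complements). Choose $$\hat{\mathbf x}^{(1)}_S\in\operatorname*{argmin}_{\mathbf x_S\in\boldsymbol\Pi_S}\sum_{i,j\in S}A_{ij}\,d(x_i,x_j),\qquad \hat x^{(2)}_i\in\operatorname*{argmin}_{z\in\mathcal C_{n_0}}\sum_{j\in S}A_{ij}\,d(z,\hat x^{(1)}_j)\quad(i\in\overline S),$$ where ties in the first minimization are broken by a measurable rule that depends only on $S$ and on $A_{SS}$. Define $\hat{\mathbf x}^{(1')}_{S'}$ and $\hat{\mathbf x}^{(2')}_{\overline{S'}}$ in the same way from $S'$. Finally choose $\widehat Q\in\operatorname{argmin}_{Q\in\mathcal O}d_\infty\big(\hat{\mathbf x}^{(2)}_{\overline S\cap\overline{S'}},Q\hat{\mathbf x}^{(2')}_{\overline S\cap\overline{S'}}\big)$, and set $\hat x_j=\hat x^{(2)}_j$ for $j\in\overline S$ and $\hat x_j=\widehat Q\hat x^{(2')}_j$ for $j\in S$. **Statement.** For all $c_e\ge0$ and $0<c_l\le c_L$ there exists a constant $C>0$, depending only on $c_e,c_l,c_L$, such that in the above setting, with probability at least $1-5/n^2$, simultaneously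 for all $(\mathbf x,f)\in\mathcal R[F,c_l,c_L,c_e]$, $$\min_{Q\in\mathcal O}d_\infty(\hat{\mathbf x},Q\mathbf x)\le C\Big(d_\infty(\mathbf x,\boldsymbol\Pi_n)+\sqrt{\frac{\log n}{n}}\Big).$$ -/

import Mathlib

open MeasureTheory ProbabilityTheory

namespace CircleLocalization

noncomputable section

/-! ### Geometry of the unit circle -/

/-- The argument of a point of the unit circle, chosen in `[0, 2π)`. -/
def argument (x : Circle) : ℝ := toIcoMod Real.two_pi_pos 0 (Complex.arg (x : ℂ))

/-- The geodesic (arc length) distance on the unit circle. -/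
def geoDist (x y : Circle) : ℝ :=
  min |argument x - argument y| (2 * Real.pi - |argument x - argument y|)

theorem argument_mem (x : Circle) : 0 ≤ argument x ∧ argument x < 2 * Real.pi := by
  have h := toIcoMod_mem_Ico Real.two_pi_pos 0 (Complex.arg (x : ℂ))
  simpa [argument] using h

theorem exp_argument (x : Circle) : Circle.exp (argument x) = x := by
  have h := self_sub_toIcoDiv_zsmul Real.two_pi_pos 0 (Complex.arg (x : ℂ))
  unfold argument
  rw [← h, zsmul_eq_mul, Circle.periodic_exp.sub_int_mul_eq, Circle.exp_arg]

/-- The maximum distance between two finite tuples of points of the circle (`0` if there is no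
index). -/
def dInf {ι : Type*} (x y : ι → Circle) : ℝ := ⨆ i, geoDist (x i) (y i)

/-- The regular grid `{1, e^{2πi/k}, …, e^{2πi(k-1)/k}}`. -/
def grid (k : ℕ) : Set Circle :=
  {z | ∃ l : Fin k, z = Circle.exp (2 * Real.pi * (l : ℕ) / k)}

/-- The tuples, indexed by a set `ι` with `k` elements, that visit each point of the regular grid
with `k` points exactly once. -/
def regularTuples (ι : Type*) (k : ℕ) : Set (ι → Circle) :=
  {y | ∃ σ : ι ≃ Fin k, ∀ j, y j = Circle.exp (2 * Real.pi * (σ j : ℕ) / k)}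

/-- The `dInf`-distance of an `n`-tuple to the (finite, nonempty) set of regular `n`-tuples. -/
def distRegular {n : ℕ} (x : Fin n → Circle) : ℝ :=
  ⨅ y : regularTuples (Fin n) n, dInf x (y : Fin n → Circle)

/-- The action on the circle of an orthogonal transformation `Q` of the plane `ℂ = ℝ²`. -/
def orth (Q : ℂ ≃ₗᵢ[ℝ] ℂ) (x : Circle) : Circle :=
  ⟨Q (x : ℂ), by simp [Submonoid.unitSphere, Circle.norm_coe]⟩

/-! ### Bi-Lipschitz affinity functions and representations -/

/-- The slack `ε_n = c_e √(log n / n)`. -/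
def slack (ce : ℝ) (n : ℕ) : ℝ := ce * Real.sqrt (Real.log n / n)

/-- The class `BL[c_l, c_L, c_e]` of bi-Lipschitz functions, at sample size `n`. -/
structure IsBiLipschitz (cl cL ce : ℝ) (n : ℕ) (f : Circle → Circle → ℝ) : Prop where
  mem_unit : ∀ x y, f x y ∈ Set.Icc (0 : ℝ) 1
  symm : ∀ x y, f x y = f y x
  upper : ∀ x y y', |f x y - f x y'| ≤ cL * geoDist y y' + slack ce n
  lower : ∀ x y y', geoDist x y' ≤ geoDist x y →
    cl * (geoDist x y - geoDist x y') - slack ce n ≤ f x y' - f x y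

/-- `(x, f)` belongs to the set `R[F, c_l, c_L, c_e]` of representations of the matrix `F`. -/
def IsRepresentation {n : ℕ} (F : Fin n → Fin n → ℝ) (cl cL ce : ℝ)
    (x : Fin n → Circle) (f : Circle → Circle → ℝ) : Prop :=
  IsBiLipschitz cl cL ce n f ∧ ∀ i j, i < j → f (x i) (x j) = F i j

/-! ### The observations and the sample splitting -/

/-- The entrywise expectation of a random matrix. -/
def meanMatrix {n : ℕ} {Ω : Type*} [MeasurableSpace Ω] (μ : Measure Ω)
    (A : Ω → Fin n → Fin n → ℝ) (i j : Fin n) : ℝ := ∫ ω, A ω i j ∂μ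

/-- The noise `E = A - 𝔼 A`. -/
def noise {n : ℕ} {Ω : Type*} [MeasurableSpace Ω] (μ : Measure Ω)
    (A : Ω → Fin n → Fin n → ℝ) (i j : Fin n) (ω : Ω) : ℝ := A ω i j - meanMatrix μ A i j

/-- `A` is a random symmetric matrix with zero diagonal, whose centered entries above the diagonal
are independent and subGaussian(1). -/
structure IsObservation {n : ℕ} {Ω : Type*} [MeasurableSpace Ω] (μ : Measure Ω)
    (A : Ω → Fin n → Fin n → ℝ) : Prop where
  measurable : Measurable A
  symm : ∀ ω i j, A ω i j = A ω j i
  diag : ∀ ω i, A ω i i = 0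
  integrable : ∀ i j, Integrable (fun ω => A ω i j) μ
  indep : iIndepFun
    (fun (p : {p : Fin n × Fin n // p.1 < p.2}) => noise μ A p.1.1 p.1.2) μ
  subGaussian : ∀ (B : Fin n → Fin n → ℝ) (t : ℝ), 0 ≤ t →
    μ.real {ω | t * Real.sqrt (∑ i, ∑ j ∈ Finset.Ioi i, B i j ^ 2)
        < ∑ i, ∑ j ∈ Finset.Ioi i, B i j * noise μ A i j ω} ≤ Real.exp (-t ^ 2 / 2)

/-- `S` is a uniform random subset of size `n₀` of the indices, `S'` is, given `S`, a uniform random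
subset of size `n₀` of the complement of `S`, and the pair is independent of the observations `A`. -/
structure IsSampling {n : ℕ} (n₀ : ℕ) {Ω : Type*} [MeasurableSpace Ω] (μ : Measure Ω)
    (A : Ω → Fin n → Fin n → ℝ) (S S' : Ω → Finset (Fin n)) : Prop where
  measurable_fst : Measurable S
  measurable_snd : Measurable S'
  card_fst : ∀ ω, (S ω).card = n₀
  card_snd : ∀ ω, (S' ω).card = n₀
  disjoint : ∀ ω, Disjoint (S ω) (S' ω)
  uniform : ∀ s s' : Finset (Fin n), s.card = n₀ → s'.card = n₀ → Disjoint s s' →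
    μ.real {ω | S ω = s ∧ S' ω = s'}
      = 1 / (n.choose n₀ : ℝ) * (1 / ((n - n₀).choose n₀ : ℝ))
  indep : IndepFun A (fun ω => (S ω, S' ω)) μ

/-! ### The Localize-and-Refine procedure -/

/-- The criterion `⟨M, D(x)⟩` of the initial localization. -/
def initialCriterion {ι : Type*} [Fintype ι] (M : ι → ι → ℝ) (x : ι → Circle) : ℝ :=
  ∑ i, ∑ j, M i j * geoDist (x i) (x j)

/-- A rule for computing the initial localization. For every set `T` of `n₀` indices it maps the
submatrix `A_{TT}` to a minimizer of the criterion among the regular tuples indexed by `T`. Ties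
are broken in an arbitrary measurable way (the rule takes finitely many values, so measurability
means that its level sets are measurable). -/
structure IsInitialRule {n : ℕ} (n₀ : ℕ)
    (loc : (T : Finset (Fin n)) → (T → T → ℝ) → T → Circle) : Prop where
  mem : ∀ T : Finset (Fin n), T.card = n₀ → ∀ M, loc T M ∈ regularTuples T n₀
  isMin : ∀ T : Finset (Fin n), T.card = n₀ → ∀ M,
    IsMinOn (initialCriterion M) (regularTuples T n₀) (loc T M)
  measurable : ∀ T : Finset (Fin n), T.card = n₀ → ∀ y, MeasurableSet {M | loc T M = y}

/-- The submatrix `A_{TT}`. -/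
def sub {n : ℕ} (A : Fin n → Fin n → ℝ) (T : Finset (Fin n)) : T → T → ℝ :=
  fun i j => A i j

/-- `x₂` is a refined localization, outside `T`, that is computed from the initial localization `x₁`
of the points indexed by `T` (the values of `x₂` on `T` play no role). -/
def IsRefinement {n : ℕ} (n₀ : ℕ) (A : Fin n → Fin n → ℝ) (T : Finset (Fin n))
    (x₁ : T → Circle) (x₂ : Fin n → Circle) : Prop :=
  ∀ i ∉ T, x₂ i ∈ grid n₀ ∧
    IsMinOn (fun z => ∑ j : T, A i j * geoDist z (x₁ j)) (grid n₀) (x₂ i)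

/-- The merging criterion `d_∞(x_R, Q y_R)`, where `R` is the set of indices outside `T ∪ T'`. -/
def mergeCriterion {n : ℕ} (T T' : Finset (Fin n)) (x y : Fin n → Circle)
    (Q : ℂ ≃ₗᵢ[ℝ] ℂ) : ℝ :=
  dInf (fun i : {i : Fin n // i ∉ T ∧ i ∉ T'} => x i) (fun i => orth Q (y i))

/-- `xhat` is an output of the Localize-and-Refine procedure on the matrix `A` and the subsets `T`
and `T'`, with the rules `loc` and `loc'` for the two initial localizations. -/
def IsOutput {n : ℕ} (n₀ : ℕ)
    (loc loc' : (T : Finset (Fin n)) → (T → T → ℝ) → T → Circle)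
    (A : Fin n → Fin n → ℝ) (T T' : Finset (Fin n)) (xhat : Fin n → Circle) : Prop :=
  ∃ (x₂ x₂' : Fin n → Circle) (Q : ℂ ≃ₗᵢ[ℝ] ℂ),
    IsRefinement n₀ A T (loc T (sub A T)) x₂ ∧
    IsRefinement n₀ A T' (loc' T' (sub A T')) x₂' ∧
    (∀ Q' : ℂ ≃ₗᵢ[ℝ] ℂ, mergeCriterion T T' x₂ x₂' Q ≤ mergeCriterion T T' x₂ x₂' Q') ∧
    (∀ j ∉ T, xhat j = x₂ j) ∧ (∀ j ∈ T, xhat j = orth Q (x₂' j))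

end

end CircleLocalization

/-! The driving estimate is a quantitative rearrangement inequality. The distances from a grid point
to a regular tuple are, up to order, always the same numbers. Since an affinity decreases with the
distance, moving from the true row `a` of distances to a permuted row `b` raises the criterion by at
least `cl / 2 * ‖b - a‖²`, minus an error linear in `b - a` (`sum_mul_rearrangement_ge`,
`geoDist_row_lower`). Setting this quadratic gain against linear errors and noise gives every bound.

For the initial localization it bounds the Frobenius distance between distance matrices, hence an
average distance between tuples up to an isometry: two well separated anchors with small row errors
determine all other points (`exists_orth_sum_sq_le`). For the refinement, a candidate at distance
`D` from the target has gain of order `k * D ^ 2` against errors of order `k * τ * D`, so the bound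
becomes uniform over the points (`geoDist_refine_le`). The two refinements are then merged: an
isometry nearly fixing half of an almost regular tuple is close to the identity
(`geoDist_orth_self_le`).

Four kinds of random input are needed. A uniform sample of an almost regular tuple is almost
regular, by a Chernoff bound over initial segments applied to each of the two samples. The initial
noise is controlled over all index sets and all pairs of tuples. The refinement noise needs only a
union over pairs of grid points, because the rows outside the sample are independent of the initial
localization; it is also controlled once for each sample.

All these events are built from one representation `x₀` that is nearly as regular as possible. Any
other representation of the same mean matrix is close to `x₀` up to an isometry
(`exists_orth_of_representations`), which yields the bound simultaneously for all of them. -/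

namespace CircleLocalization

/-! ### The geodesic distance as the norm of an angle -/

/-- The argument of a point of the circle, as an angle. -/
noncomputable def angle (x : Circle) : Real.Angle := (argument x : Real.Angle)

theorem angle_exp (s : ℝ) : angle (Circle.exp s) = (s : Real.Angle) := by
  obtain ⟨m, hm⟩ := Circle.exp_eq_exp.1 (exp_argument (Circle.exp s))
  rw [angle, Real.Angle.angle_eq_iff_two_pi_dvd_sub]
  exact ⟨m, by rw [hm]; ring⟩

theorem angle_mul (x y : Circle) : angle (x * y) = angle x + angle y := by
  rw [← exp_argument x, ← exp_argument y, ← Circle.exp_add, angle_exp, angle_exp, angle_exp,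
    Real.Angle.coe_add]

theorem angle_one : angle 1 = 0 := by
  rw [← Circle.exp_zero, angle_exp, Real.Angle.coe_zero]

theorem angle_inv (x : Circle) : angle x⁻¹ = -angle x := by
  have h := angle_mul x x⁻¹
  rw [mul_inv_cancel, angle_one] at h
  exact (neg_eq_of_add_eq_zero_right h.symm).symm

theorem norm_angle_coe {u : ℝ} (hu : |u| ≤ Real.pi) : ‖(u : Real.Angle)‖ = |u| := by
  refine (AddCircle.norm_coe_eq_abs_iff (2 * Real.pi) Real.two_pi_pos.ne').2 ?_
  rw [abs_of_pos Real.two_pi_pos]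
  linarith

theorem norm_angle_le_pi (t : Real.Angle) : ‖t‖ ≤ Real.pi := by
  have h : ‖t‖ ≤ |2 * Real.pi| / 2 := AddCircle.norm_le_half_period _ Real.two_pi_pos.ne'
  rw [abs_of_pos Real.two_pi_pos] at h
  linarith

theorem norm_angle_coe_le (u : ℝ) : ‖(u : Real.Angle)‖ ≤ |u| := by
  rcases le_total |u| Real.pi with h | h
  · exact (norm_angle_coe h).le
  · exact (norm_angle_le_pi _).trans h

theorem exists_angle_eq_norm (t : Real.Angle) :
    t = ((‖t‖ : ℝ) : Real.Angle) ∨ t = -((‖t‖ : ℝ) : Real.Angle) := by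
  have h := norm_angle_coe (Real.Angle.abs_toReal_le_pi t)
  rw [Real.Angle.coe_toReal] at h
  rcases abs_choice t.toReal with h' | h'
  · left; rw [h, h', Real.Angle.coe_toReal]
  · right; rw [h, h', Real.Angle.coe_neg, Real.Angle.coe_toReal, neg_neg]

theorem geoDist_eq_norm (x y : Circle) : geoDist x y = ‖angle x - angle y‖ := by
  have hx := argument_mem x
  have hy := argument_mem y
  unfold geoDist angle
  rw [← Real.Angle.coe_sub]
  generalize hu : argument x - argument y = u
  have h1 : |u| < 2 * Real.pi := abs_lt.2 ⟨by linarith, by linarith⟩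
  rcases le_or_gt |u| Real.pi with h | h
  · rw [norm_angle_coe h, min_eq_left (by linarith)]
  · rw [min_eq_right (by linarith)]
    rcases abs_cases u with ⟨h2, h3⟩ | ⟨h2, h3⟩
    · have : (u : Real.Angle) = ((u - 2 * Real.pi : ℝ) : Real.Angle) := by simp
      have h4 : |u - 2 * Real.pi| = 2 * Real.pi - u := by rw [abs_of_neg (by linarith)]; ring
      rw [this, norm_angle_coe (by linarith), h2, h4]
    · have : (u : Real.Angle) = ((u + 2 * Real.pi : ℝ) : Real.Angle) := by simp
      have h4 : |u + 2 * Real.pi| = u + 2 * Real.pi := abs_of_pos (by linarith)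
      rw [this, norm_angle_coe (by linarith), h2, h4]
      ring

theorem geoDist_self (x : Circle) : geoDist x x = 0 := by simp [geoDist_eq_norm]

theorem geoDist_nonneg (x y : Circle) : 0 ≤ geoDist x y := by
  rw [geoDist_eq_norm]; exact norm_nonneg _

theorem geoDist_comm (x y : Circle) : geoDist x y = geoDist y x := by
  rw [geoDist_eq_norm, geoDist_eq_norm, norm_sub_rev]

theorem geoDist_triangle (x y z : Circle) : geoDist x z ≤ geoDist x y + geoDist y z := by
  simp only [geoDist_eq_norm]
  exact norm_sub_le_norm_sub_add_norm_sub _ _ _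

theorem geoDist_le_pi (x y : Circle) : geoDist x y ≤ Real.pi := by
  rw [geoDist_eq_norm]; exact norm_angle_le_pi _

theorem abs_geoDist_sub_le (x y z : Circle) : |geoDist x z - geoDist y z| ≤ geoDist x y := by
  rw [abs_le]
  have h1 := geoDist_triangle x y z
  have h2 := geoDist_triangle y x z
  rw [geoDist_comm y x] at h2
  constructor <;> linarith

theorem geoDist_mul_left (a x y : Circle) : geoDist (a * x) (a * y) = geoDist x y := by
  simp only [geoDist_eq_norm, angle_mul, add_sub_add_left_eq_sub]

theorem geoDist_inv (x y : Circle) : geoDist x⁻¹ y⁻¹ = geoDist x y := by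
  rw [geoDist_comm x y]
  simp only [geoDist_eq_norm, angle_inv]
  congr 1; abel

theorem geoDist_exp_le (s t : ℝ) : geoDist (Circle.exp s) (Circle.exp t) ≤ |s - t| := by
  rw [geoDist_eq_norm, angle_exp, angle_exp, ← Real.Angle.coe_sub]
  exact norm_angle_coe_le _

/-! ### Orthogonal transformations -/

theorem orth_rotation (a x : Circle) : orth (rotation a) x = a * x := by
  apply Circle.ext
  simp [orth, rotation_apply]

theorem orth_reflection (a x : Circle) :
    orth (Complex.conjLIE.trans (rotation a)) x = a * x⁻¹ := by
  apply Circle.ext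
  rw [Circle.coe_mul, Circle.coe_inv_eq_conj]
  simp [orth, rotation_apply]

theorem orth_cases (Q : ℂ ≃ₗᵢ[ℝ] ℂ) :
    ∃ a : Circle, (∀ x, orth Q x = a * x) ∨ (∀ x, orth Q x = a * x⁻¹) := by
  obtain ⟨a, rfl | rfl⟩ := linear_isometry_complex Q
  · exact ⟨a, Or.inl (orth_rotation a)⟩
  · exact ⟨a, Or.inr (orth_reflection a)⟩

theorem geoDist_orth (Q : ℂ ≃ₗᵢ[ℝ] ℂ) (x y : Circle) :
    geoDist (orth Q x) (orth Q y) = geoDist x y := by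
  obtain ⟨a, h | h⟩ := orth_cases Q
  · rw [h, h, geoDist_mul_left]
  · rw [h, h, geoDist_mul_left, geoDist_inv]

theorem orth_trans (P Q : ℂ ≃ₗᵢ[ℝ] ℂ) (x : Circle) : orth (P.trans Q) x = orth Q (orth P x) := rfl

theorem orth_orth_symm (Q : ℂ ≃ₗᵢ[ℝ] ℂ) (x : Circle) : orth Q (orth Q.symm x) = x := by
  apply Circle.ext; simp [orth]

/-- A difference of distances to `a` is, up to sign, a distance, possibly after a reflection
fixing `a`. -/
theorem abs_geoDist_sub_eq (a u v : Circle) :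
    |geoDist u a - geoDist v a| = geoDist u v ∨
      |geoDist u a - geoDist v a| = geoDist u (a * a * v⁻¹) := by
  simp only [geoDist_eq_norm, angle_mul, angle_inv]
  set s := angle u - angle a with hs
  set t := angle v - angle a with ht
  have h1 : angle u - angle v = s - t := by rw [hs, ht]; abel
  have h2 : angle u - (angle a + angle a + -angle v) = s + t := by rw [hs, ht]; abel
  rw [h1, h2]
  -- Both norms lie in `[0, π]`, so their difference is already the shortest representative of its
  -- angle.
  have key : ‖(((‖s‖ - ‖t‖ : ℝ)) : Real.Angle)‖ = |‖s‖ - ‖t‖| := by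
    apply norm_angle_coe
    have := norm_angle_le_pi s
    have := norm_angle_le_pi t
    have := norm_nonneg s
    have := norm_nonneg t
    rw [abs_le]; constructor <;> linarith
  rw [← key, Real.Angle.coe_sub]
  rcases exists_angle_eq_norm s with h | h <;> rcases exists_angle_eq_norm t with h' | h'
  · left; rw [← h, ← h']
  · right; rw [← h, ← neg_eq_iff_eq_neg.2 h', sub_neg_eq_add]
  · right; rw [← h', ← neg_eq_iff_eq_neg.2 h, ← norm_neg]; congr 1; abel
  · left; rw [← neg_eq_iff_eq_neg.2 h', ← neg_eq_iff_eq_neg.2 h, ← norm_neg]; congr 1; abel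

/-- Doubling an angle of size at most `π / 2` does not wrap around. Squares matter because the
reflection `z ↦ c * z⁻¹` fixes exactly the square roots of `c`. -/
theorem geoDist_sq_eq {a b : Circle} (h : geoDist a b ≤ Real.pi / 2) :
    geoDist (a * a) (b * b) = 2 * geoDist a b := by
  simp only [geoDist_eq_norm, angle_mul] at *
  set s := angle a - angle b with hs
  have h1 : angle a + angle a - (angle b + angle b) = s + s := by rw [hs]; abel
  rw [h1]
  have key : ‖((‖s‖ + ‖s‖ : ℝ) : Real.Angle)‖ = 2 * ‖s‖ := by
    have := norm_nonneg s
    rw [norm_angle_coe, abs_of_nonneg (by linarith)]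
    · ring
    · rw [abs_of_nonneg (by linarith)]; linarith
  rw [← key, Real.Angle.coe_add]
  rcases exists_angle_eq_norm s with h' | h'
  · rw [← h']
  · rw [← neg_eq_iff_eq_neg.2 h', ← norm_neg]; congr 1; abel

/-- The distances to two well separated anchors determine a point of the circle. -/
theorem geoDist_le_anchors {a b : Circle} (h1 : Real.pi / 8 ≤ geoDist a b)
    (h2 : geoDist a b ≤ Real.pi / 2) (u v : Circle) :
    geoDist u v ≤ 4 * (|geoDist u a - geoDist v a| + |geoDist u b - geoDist v b|) := by
  have ha := abs_nonneg (geoDist u a - geoDist v a)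
  have hb := abs_nonneg (geoDist u b - geoDist v b)
  have h0 := geoDist_nonneg u v
  rcases abs_geoDist_sub_eq a u v with h | h
  · linarith
  rcases abs_geoDist_sub_eq b u v with h' | h'
  · linarith
  -- Remaining case: `u` is compared with the mirror images of `v` through both anchors. These
  -- images are `2 * geoDist a b ≥ π / 4` apart, so the two errors sum to at least `π / 4` and the
  -- factor 4 covers any distance.
  have h3 := geoDist_triangle (a * a * v⁻¹) u (b * b * v⁻¹)
  rw [mul_comm _ v⁻¹, mul_comm _ v⁻¹, geoDist_mul_left, geoDist_sq_eq h2, mul_comm v⁻¹,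
    mul_comm v⁻¹, geoDist_comm _ u, ← h, ← h'] at h3
  have := geoDist_le_pi u v
  linarith

/-- Two points can be moved by an isometry so that the first one matches exactly and the second one
matches up to the difference of their distances. -/
theorem exists_orth_align (a b a' b' : Circle) :
    ∃ Q : ℂ ≃ₗᵢ[ℝ] ℂ, orth Q a = a' ∧
      geoDist b' (orth Q b) = |geoDist b' a' - geoDist b a| := by
  have h0 : geoDist (a' * a⁻¹ * b) a' = geoDist b a := by
    conv_lhs => rw [show a' = a' * a⁻¹ * a by group]
    rw [show a' * a⁻¹ * a * a⁻¹ * b = a' * a⁻¹ * b by group, geoDist_mul_left]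
  -- The rotation sending `a` to `a'` places `b` correctly up to the reflection that fixes `a'`; the
  -- better of the two is kept.
  rcases abs_geoDist_sub_eq a' b' (a' * a⁻¹ * b) with h | h
  · refine ⟨rotation (a' * a⁻¹), ?_, ?_⟩
    · rw [orth_rotation]; group
    · rw [orth_rotation, ← h, h0]
  · refine ⟨Complex.conjLIE.trans (rotation (a' * a)), ?_, ?_⟩
    · rw [orth_reflection]; group
    · rw [orth_reflection, ← h0, h]
      congr 1
      simp only [mul_inv, inv_inv]
      rw [show a' * a' * (a'⁻¹ * a * b⁻¹) = a' * (a' * a'⁻¹) * a * b⁻¹ by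
        simp only [mul_assoc], mul_inv_cancel, mul_one]

/-! ### Regular grids -/

/-- The point of index `l` of the regular grid. -/
noncomputable def gridPoint (k : ℕ) [NeZero k] (l : ZMod k) : Circle := ZMod.toCircle l

theorem gridPoint_add {k : ℕ} [NeZero k] (l m : ZMod k) :
    gridPoint k (l + m) = gridPoint k l * gridPoint k m :=
  AddChar.map_add_eq_mul _ _ _

theorem gridPoint_natCast {k : ℕ} [NeZero k] (l : ℕ) :
    gridPoint k l = Circle.exp (2 * Real.pi * l / k) := by
  apply Circle.ext
  rw [gridPoint, ZMod.toCircle_natCast, Circle.coe_exp]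
  congr 1
  push_cast
  ring

theorem geoDist_gridPoint {k : ℕ} [NeZero k] (l m : ZMod k) :
    geoDist (gridPoint k l) (gridPoint k m) = geoDist (gridPoint k (l - m)) 1 := by
  conv_lhs => rw [show l = m + (l - m) by ring, gridPoint_add]
  conv_lhs => rw [show gridPoint k m = gridPoint k m * 1 by rw [mul_one], mul_assoc, one_mul]
  exact geoDist_mul_left _ _ _

theorem gridPoint_mem_grid {k : ℕ} [NeZero k] (l : ZMod k) : gridPoint k l ∈ grid k := by
  refine ⟨⟨l.val, ZMod.val_lt l⟩, ?_⟩
  conv_lhs => rw [← ZMod.natCast_zmod_val l]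
  exact gridPoint_natCast _

theorem exists_gridPoint {k : ℕ} [NeZero k] {z : Circle} (hz : z ∈ grid k) :
    ∃ l, z = gridPoint k l := by
  obtain ⟨l, hl⟩ := hz
  exact ⟨((l : ℕ) : ZMod k), by rw [gridPoint_natCast, hl]⟩

theorem exists_equiv_gridPoint {ι : Type*} {k : ℕ} [NeZero k] {y : ι → Circle}
    (hy : y ∈ regularTuples ι k) : ∃ τ : ι ≃ ZMod k, ∀ j, y j = gridPoint k (τ j) := by
  obtain ⟨σ, hσ⟩ := hy
  refine ⟨σ.trans (ZMod.finEquiv k).toEquiv, fun j => ?_⟩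
  rw [hσ j]
  have : (σ.trans (ZMod.finEquiv k).toEquiv) j = (((σ j : ℕ)) : ZMod k) := by
    obtain _ | k := k
    · exact absurd rfl (NeZero.ne 0)
    · exact (ZMod.natCast_zmod_val (n := k + 1) (σ j)).symm
  rw [this, gridPoint_natCast]

/-- The distances from a point of the grid to a regular tuple do not depend, up to the order, on the
point and on the tuple. -/
theorem exists_perm_geoDist {ι : Type*} {k : ℕ} [NeZero k] {y y' : ι → Circle}
    (hy : y ∈ regularTuples ι k) (hy' : y' ∈ regularTuples ι k) {z z' : Circle} (hz : z ∈ grid k)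
    (hz' : z' ∈ grid k) :
    ∃ σ : Equiv.Perm ι, ∀ j, geoDist z' (y' j) = geoDist z (y (σ j)) := by
  obtain ⟨τ, hτ⟩ := exists_equiv_gridPoint hy
  obtain ⟨τ', hτ'⟩ := exists_equiv_gridPoint hy'
  obtain ⟨m, rfl⟩ := exists_gridPoint hz
  obtain ⟨m', rfl⟩ := exists_gridPoint hz'
  -- Distances on the grid depend only on differences of indices in `ZMod k`, so a shift by `m - m'`
  -- matches them.
  refine ⟨τ'.trans ((Equiv.addRight (m - m')).trans τ.symm), fun j => ?_⟩
  rw [hτ, hτ', geoDist_gridPoint, geoDist_gridPoint m]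
  simp only [Equiv.trans_apply, Equiv.apply_symm_apply, Equiv.coe_addRight]
  congr 2
  ring

theorem mem_grid_of_regular {ι : Type*} {k : ℕ} [NeZero k] {y : ι → Circle}
    (hy : y ∈ regularTuples ι k) (j : ι) : y j ∈ grid k := by
  obtain ⟨τ, hτ⟩ := exists_equiv_gridPoint hy
  rw [hτ]; exact gridPoint_mem_grid _

theorem exists_mem_grid_geoDist_le (k : ℕ) [NeZero k] (x : Circle) :
    ∃ z ∈ grid k, geoDist x z ≤ 2 * Real.pi / k := by
  have hk : (0 : ℝ) < k := by exact_mod_cast Nat.pos_of_ne_zero (NeZero.ne k)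
  have hpi := Real.two_pi_pos
  have h0 : 0 ≤ argument x * k / (2 * Real.pi) :=
    div_nonneg (mul_nonneg (argument_mem x).1 hk.le) hpi.le
  have h1 := Nat.floor_le h0
  have h2 := Nat.lt_floor_add_one (argument x * k / (2 * Real.pi))
  set l := ⌊argument x * k / (2 * Real.pi)⌋₊
  refine ⟨gridPoint k l, gridPoint_mem_grid _, ?_⟩
  have h3 : argument x - 2 * Real.pi * l / k
      = (argument x * k / (2 * Real.pi) - l) * (2 * Real.pi / k) := by
    field_simp
  calc geoDist x (gridPoint k l)
      = geoDist (Circle.exp (argument x)) (Circle.exp (2 * Real.pi * l / k)) := by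
        rw [exp_argument, gridPoint_natCast]
    _ ≤ |argument x - 2 * Real.pi * l / k| := geoDist_exp_le _ _
    _ = |argument x * k / (2 * Real.pi) - l| * (2 * Real.pi / k) := by
        rw [h3, abs_mul, abs_of_nonneg (a := 2 * Real.pi / k) (by positivity)]
    _ ≤ 1 * (2 * Real.pi / k) := by
        gcongr
        rw [abs_le]; constructor <;> linarith
    _ = 2 * Real.pi / k := one_mul _

/-! ### A quadratic lower bound in the rearrangement inequality -/

/-- By `hg`, the weight `g + c * a` is nonincreasing in `a` up to an error `e`, so the classical
inequality applies to a monotone envelope of it. As `a` and `b` have equal sums of squares, the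
added part `c * a` contributes exactly `-(c / 2) * ∑ (b - a) ^ 2`, which is the quadratic gain. -/
theorem sum_mul_rearrangement_ge {ι : Type*} [Fintype ι] {a b g : ι → ℝ} {c e : ℝ}
    (σ : Equiv.Perm ι) (hb : ∀ j, b j = a (σ j))
    (hg : ∀ j l, a l ≤ a j → c * (a j - a l) - e ≤ g l - g j) :
    c / 2 * ∑ j, (b j - a j) ^ 2 - e * ∑ j, |b j - a j| ≤ ∑ j, g j * (b j - a j) := by
  classical
  have hne : ∀ j, (Finset.univ.filter fun l => a j ≤ a l).Nonempty :=
    fun j => ⟨j, by simp⟩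
  set h : ι → ℝ := fun j => g j + c * a j with hh
  -- The least function above `h` that is nonincreasing in `a`; it exceeds `h` by at most `e`.
  set ht : ι → ℝ := fun j => (Finset.univ.filter fun l => a j ≤ a l).sup' (hne j) h with hht
  have h1 : ∀ j, h j ≤ ht j := fun j => Finset.le_sup' h (by simp)
  have h2 : ∀ j, ht j ≤ h j + e := by
    intro j
    refine Finset.sup'_le _ _ fun l hl => ?_
    have := hg l j (by simpa using hl)
    simp only [hh]
    linarith
  have h3 : Antivary ht a := by
    intro i j hij
    refine Finset.sup'_mono _ (fun l hl => ?_) _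
    simp only [Finset.mem_filter, Finset.mem_univ, true_and] at hl ⊢
    linarith
  have h4 : ∑ j, ht j * a j ≤ ∑ j, ht j * b j := by
    simp only [hb]
    exact h3.sum_mul_le_sum_mul_comp_perm
  have h5 : ∑ j, b j ^ 2 = ∑ j, a j ^ 2 := by
    simp only [hb]
    exact Equiv.sum_comp σ fun j => a j ^ 2
  have h6 : ∑ j, (ht j * (b j - a j) - e * |b j - a j|) ≤ ∑ j, h j * (b j - a j) := by
    refine Finset.sum_le_sum fun j _ => ?_
    have h7 : (ht j - h j) * (b j - a j) ≤ e * |b j - a j| :=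
      (mul_le_mul_of_nonneg_left (le_abs_self _) (by linarith [h1 j])).trans
        (mul_le_mul_of_nonneg_right (by linarith [h2 j]) (abs_nonneg _))
    linarith
  have h8 : ∑ j, h j * (b j - a j)
      = ∑ j, g j * (b j - a j) - c / 2 * ∑ j, (b j - a j) ^ 2 := by
    have h9 : ∀ j, h j * (b j - a j)
        = g j * (b j - a j) - c / 2 * (b j - a j) ^ 2 + c / 2 * (b j ^ 2 - a j ^ 2) := by
      intro j; simp only [hh]; ring
    simp only [h9, Finset.sum_add_distrib, Finset.sum_sub_distrib, ← Finset.mul_sum, h5]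
    ring
  rw [Finset.sum_sub_distrib, ← Finset.mul_sum] at h6
  simp only [mul_sub, Finset.sum_sub_distrib] at h4 h6 h8 ⊢
  linarith

/-- The rearrangement bound when the weights approximate a bi-Lipschitz function of the points. -/
theorem IsBiLipschitz.sum_mul_ge {cl cL ce : ℝ} {n : ℕ} {f : Circle → Circle → ℝ}
    (hf : IsBiLipschitz cl cL ce n f) {ι : Type*} [Fintype ι] {p : Circle} {v : ι → Circle}
    {a b g e : ι → ℝ} (ha : ∀ j, a j = geoDist p (v j)) (σ : Equiv.Perm ι)
    (hb : ∀ j, b j = a (σ j)) (hg : ∀ j, b j ≠ a j → |g j - f p (v j)| ≤ e j) :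
    cl / 2 * ∑ j, (b j - a j) ^ 2 - ∑ j, (e j + slack ce n) * |b j - a j|
      ≤ ∑ j, g j * (b j - a j) := by
  have h1 := sum_mul_rearrangement_ge (c := cl) (e := slack ce n) (g := fun j => f p (v j)) σ hb
    (fun j l hjl => by
      rw [ha, ha] at *
      exact hf.lower p (v j) (v l) hjl)
  have h2 : ∑ j, f p (v j) * (b j - a j) - ∑ j, e j * |b j - a j| ≤ ∑ j, g j * (b j - a j) := by
    rw [← Finset.sum_sub_distrib]
    refine Finset.sum_le_sum fun j _ => ?_
    by_cases hj : b j = a j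
    · simp [hj]
    · have h3 : |(g j - f p (v j)) * (b j - a j)| ≤ e j * |b j - a j| := by
        rw [abs_mul]
        exact mul_le_mul_of_nonneg_right (hg j hj) (abs_nonneg _)
      have := (abs_le.1 h3).1
      linarith
  simp only [add_mul, Finset.sum_add_distrib, ← Finset.mul_sum]
  linarith

theorem IsBiLipschitz.abs_sub_le {cl cL ce : ℝ} {n : ℕ} {f : Circle → Circle → ℝ}
    (hf : IsBiLipschitz cl cL ce n f) (x x' y y' : Circle) :
    |f x y - f x' y'| ≤ cL * (geoDist x x' + geoDist y y') + 2 * slack ce n := by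
  have h1 := abs_le.1 (hf.upper x y y')
  have h2 := abs_le.1 (hf.upper y' x x')
  rw [hf.symm y' x, hf.symm y' x'] at h2
  rw [abs_le]
  constructor <;> linarith [h1.1, h1.2, h2.1, h2.2]

/-! ### Well separated points of the grid -/

theorem geoDist_gridPoint_one {k : ℕ} [NeZero k] {q : ℕ} (hq : 4 * q ≤ k) :
    geoDist (gridPoint k q) 1 = 2 * Real.pi * q / k := by
  have hk : (0 : ℝ) < k := by exact_mod_cast Nat.pos_of_ne_zero (NeZero.ne k)
  have hq' : (4 : ℝ) * q ≤ k := by exact_mod_cast hq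
  have hpi := Real.pi_pos
  rw [geoDist_eq_norm, angle_one, sub_zero, gridPoint_natCast, angle_exp, norm_angle_coe,
    abs_of_nonneg (by positivity)]
  rw [abs_of_nonneg (by positivity), div_le_iff₀ hk]
  nlinarith

theorem geoDist_shift_mem {k : ℕ} [NeZero k] {q : ℕ} (h1 : k ≤ 16 * q) (h2 : 4 * q ≤ k)
    (l : ZMod k) :
    Real.pi / 8 ≤ geoDist (gridPoint k l) (gridPoint k (l + q)) ∧
      geoDist (gridPoint k l) (gridPoint k (l + q)) ≤ Real.pi / 2 := by
  have hk : (0 : ℝ) < k := by exact_mod_cast Nat.pos_of_ne_zero (NeZero.ne k)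
  have h1' : (k : ℝ) ≤ 16 * q := by exact_mod_cast h1
  have h2' : (4 : ℝ) * q ≤ k := by exact_mod_cast h2
  have hpi := Real.pi_pos
  rw [geoDist_comm, geoDist_gridPoint, add_sub_cancel_left, geoDist_gridPoint_one h2]
  constructor
  · rw [le_div_iff₀ hk]; nlinarith
  · rw [div_le_iff₀ hk]; nlinarith

/-- The distances to a regular tuple separate the points of the circle, quadratically on average. -/
theorem card_mul_geoDist_sq_le {ι : Type*} [Fintype ι] {k : ℕ} [NeZero k] (hk : 8 ≤ k)
    {w : ι → Circle} (hw : w ∈ regularTuples ι k) (z z' : Circle) :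
    k * geoDist z z' ^ 2 ≤ 64 * ∑ j, (geoDist z (w j) - geoDist z' (w j)) ^ 2 := by
  obtain ⟨τ, hτ⟩ := exists_equiv_gridPoint hw
  set m := k / 8
  have hm1 : k ≤ 16 * m := by omega
  have hm2 : 4 * m ≤ k := by omega
  -- Each point is paired with the one about an eighth of a turn further, so that both serve as
  -- anchors. The bound `k ≤ 16 * m` needs `8 ≤ k`.
  set ρ : Equiv.Perm ι := τ.trans ((Equiv.addRight (m : ZMod k)).trans τ.symm) with hρ
  set p : ι → ℝ := fun j => geoDist z (w j) - geoDist z' (w j) with hp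
  have h1 : ∀ j, geoDist z z' ^ 2 ≤ 32 * (p j ^ 2 + p (ρ j) ^ 2) := by
    intro j
    have hj : w (ρ j) = gridPoint k (τ j + m) := by rw [hτ]; simp [hρ]
    have h2 := geoDist_shift_mem hm1 hm2 (τ j)
    rw [← hτ, ← hj] at h2
    have h3 := geoDist_le_anchors h2.1 h2.2 z z'
    have h4 := geoDist_nonneg z z'
    have h5 : geoDist z z' ≤ 4 * (|p j| + |p (ρ j)|) := h3
    calc geoDist z z' ^ 2 ≤ (4 * (|p j| + |p (ρ j)|)) ^ 2 := by gcongr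
      _ ≤ 32 * (|p j| ^ 2 + |p (ρ j)| ^ 2) := by nlinarith [sq_nonneg (|p j| - |p (ρ j)|)]
      _ = _ := by rw [sq_abs, sq_abs]
  have hcard : (Fintype.card ι : ℝ) = k := by
    rw [Fintype.card_congr τ, ZMod.card]
  calc k * geoDist z z' ^ 2 = ∑ j : ι, geoDist z z' ^ 2 := by
        rw [Finset.sum_const, Finset.card_univ, nsmul_eq_mul, hcard]
    _ ≤ ∑ j, 32 * (p j ^ 2 + p (ρ j) ^ 2) := Finset.sum_le_sum fun j _ => h1 j
    _ = 64 * ∑ j, p j ^ 2 := by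
        rw [← Finset.mul_sum, Finset.sum_add_distrib, Equiv.sum_comp ρ fun j => p j ^ 2]
        ring

theorem card_of_regular {ι : Type*} [Fintype ι] {k : ℕ} {w : ι → Circle}
    (hw : w ∈ regularTuples ι k) : Fintype.card ι = k := by
  obtain ⟨σ, -⟩ := hw
  rw [Fintype.card_congr σ, Fintype.card_fin]

theorem sum_abs_le_of_sum_sq_le {ι : Type*} [Fintype ι] {u : ι → ℝ} {H : ℝ} (hH : 0 ≤ H)
    (h : ∑ j, u j ^ 2 ≤ H ^ 2 * Fintype.card ι) : ∑ j, |u j| ≤ H * Fintype.card ι := by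
  have h1 := sq_sum_le_card_mul_sum_sq (s := Finset.univ) (f := fun j => |u j|)
  simp only [sq_abs, Finset.card_univ] at h1
  refine abs_le_of_sq_le_sq' ?_ (by positivity) |>.2
  nlinarith [(Nat.cast_nonneg (Fintype.card ι) : (0:ℝ) ≤ Fintype.card ι)]

/-- If the distance matrices of two regular tuples are close in Frobenius norm, then the tuples are
close, up to an isometry. -/
theorem exists_orth_sum_sq_le {ι : Type*} [Fintype ι] {k : ℕ} [NeZero k] (hk : 8 ≤ k)
    {w y : ι → Circle} (hw : w ∈ regularTuples ι k) (hy : y ∈ regularTuples ι k) {H : ℝ}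
    (hH : ∑ i, ∑ j, (geoDist (w i) (w j) - geoDist (y i) (y j)) ^ 2 ≤ H ^ 2 * k ^ 2) :
    ∃ Q : ℂ ≃ₗᵢ[ℝ] ℂ, ∑ j, geoDist (w j) (orth Q (y j)) ^ 2 ≤ (56 * H) ^ 2 * k := by
  classical
  have hcard := card_of_regular hw
  have hk0 : (0 : ℝ) < k := by exact_mod_cast Nat.pos_of_ne_zero (NeZero.ne k)
  have hne : (Finset.univ : Finset ι).Nonempty := by
    rw [← Finset.card_pos, Finset.card_univ, hcard]; omega
  set Δ : ι → ι → ℝ := fun i j => geoDist (w i) (w j) - geoDist (y i) (y j) with hΔ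
  set R : ι → ℝ := fun i => ∑ j, Δ i j ^ 2 with hR
  -- First anchor: a row whose error is at most average.
  obtain ⟨i₁, -, hi₁⟩ : ∃ i ∈ (Finset.univ : Finset ι), R i ≤ H ^ 2 * k := by
    refine Finset.exists_le_of_sum_le hne ?_
    rw [Finset.sum_const, Finset.card_univ, hcard, nsmul_eq_mul]
    calc ∑ i, R i ≤ H ^ 2 * k ^ 2 := hH
      _ = _ := by ring
  obtain ⟨τ, hτ⟩ := exists_equiv_gridPoint hy
  set m := k / 8 with hm
  set J : ℕ → ι := fun q => τ.symm (τ i₁ + q) with hJ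
  have hinj : Set.InjOn J (Finset.Ico m (2 * m) : Finset ℕ) := by
    intro q hq q' hq' hqq
    simp only [Finset.coe_Ico, Set.mem_Ico] at hq hq'
    have h1 : ((q : ℕ) : ZMod k) = (q' : ℕ) := by simpa [hJ] using hqq
    rw [ZMod.natCast_eq_natCast_iff', Nat.mod_eq_of_lt (by omega), Nat.mod_eq_of_lt (by omega)] at h1
    exact h1
  -- Second anchor, by averaging over `m ≥ k / 16` indices at the right separation from the first:
  -- it needs both a small row error and a small mismatch with the first anchor. The total is at
  -- most `2 * H ^ 2 * k ^ 2`, whence 32.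
  obtain ⟨q, hq, hi₂⟩ : ∃ q ∈ Finset.Ico m (2 * m),
      k * Δ i₁ (J q) ^ 2 + R (J q) ≤ 32 * H ^ 2 * k := by
    refine Finset.exists_le_of_sum_le (by rw [Finset.nonempty_Ico]; omega) ?_
    rw [Finset.sum_const, Nat.card_Ico, nsmul_eq_mul, Finset.sum_add_distrib, ← Finset.mul_sum]
    have h1 : ∑ q ∈ Finset.Ico m (2 * m), Δ i₁ (J q) ^ 2 ≤ R i₁ := by
      rw [← Finset.sum_image (f := fun j => Δ i₁ j ^ 2) hinj]
      exact Finset.sum_le_univ_sum_of_nonneg fun j => sq_nonneg _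
    have h2 : ∑ q ∈ Finset.Ico m (2 * m), R (J q) ≤ H ^ 2 * k ^ 2 := by
      rw [← Finset.sum_image (f := fun j => R j) hinj]
      exact (Finset.sum_le_univ_sum_of_nonneg fun j =>
        Finset.sum_nonneg fun l _ => sq_nonneg _).trans hH
    have h3 : (k : ℝ) ≤ 16 * m := by exact_mod_cast (by omega : k ≤ 16 * m)
    have h4 : ((2 * m - m : ℕ) : ℝ) = m := by rw [two_mul, Nat.add_sub_cancel]
    rw [h4]
    have h5 : 2 * H ^ 2 * k * k ≤ 2 * H ^ 2 * k * (16 * m) := by gcongr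
    nlinarith [mul_le_mul_of_nonneg_left (h1.trans hi₁) hk0.le]
  set i₂ := J q
  have hsep := geoDist_shift_mem (k := k) (q := q)
    (by simp only [Finset.mem_Ico] at hq; omega) (by simp only [Finset.mem_Ico] at hq; omega) (τ i₁)
  have hy2 : gridPoint k (τ i₁ + q) = y i₂ := by rw [hτ]; simp [i₂, hJ]
  rw [hy2, ← hτ] at hsep
  have hR2 : R i₂ ≤ 32 * H ^ 2 * k := by nlinarith [sq_nonneg (Δ i₁ i₂)]
  have hD : Δ i₁ i₂ ^ 2 ≤ 32 * H ^ 2 := by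
    have : 0 ≤ R i₂ := Finset.sum_nonneg fun l _ => sq_nonneg _
    nlinarith
  obtain ⟨Q, hQ1, hQ2⟩ := exists_orth_align (y i₁) (y i₂) (w i₁) (w i₂)
  have hQ3 : geoDist (w i₂) (orth Q (y i₂)) = |Δ i₁ i₂| := by
    rw [hQ2, geoDist_comm (w i₂), geoDist_comm (y i₂)]
  refine ⟨Q, ?_⟩
  have h1 : ∀ j, geoDist (w j) (orth Q (y j)) ^ 2
      ≤ 48 * (Δ i₁ j ^ 2 + Δ i₂ j ^ 2 + Δ i₁ i₂ ^ 2) := by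
    intro j
    rw [← geoDist_orth Q] at hsep
    have h2 := geoDist_le_anchors hsep.1 hsep.2 (w j) (orth Q (y j))
    rw [geoDist_orth, geoDist_orth, hQ1] at h2
    have h3 : |geoDist (w j) (w i₁) - geoDist (y j) (y i₁)| = |Δ i₁ j| := by
      rw [geoDist_comm (w j), geoDist_comm (y j)]
    have h4 : |geoDist (w j) (orth Q (y i₂)) - geoDist (y j) (y i₂)| ≤ |Δ i₂ j| + |Δ i₁ i₂| := by
      rw [geoDist_comm (w j), geoDist_comm (y j), ← hQ3]
      have h5 := abs_geoDist_sub_le (orth Q (y i₂)) (w i₂) (w j)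
      rw [geoDist_comm (orth Q (y i₂)) (w i₂)] at h5
      calc |geoDist (orth Q (y i₂)) (w j) - geoDist (y i₂) (y j)|
          = |Δ i₂ j + (geoDist (orth Q (y i₂)) (w j) - geoDist (w i₂) (w j))| := by
            congr 1; simp only [hΔ]; ring
        _ ≤ _ := (abs_add_le _ _).trans (by linarith)
    have h6 : geoDist (w j) (orth Q (y j)) ≤ 4 * (|Δ i₁ j| + (|Δ i₂ j| + |Δ i₁ i₂|)) := by
      rw [h3] at h2; linarith
    have h7 := geoDist_nonneg (w j) (orth Q (y j))
    calc geoDist (w j) (orth Q (y j)) ^ 2 ≤ (4 * (|Δ i₁ j| + (|Δ i₂ j| + |Δ i₁ i₂|))) ^ 2 := by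
          gcongr
      _ ≤ 48 * (|Δ i₁ j| ^ 2 + |Δ i₂ j| ^ 2 + |Δ i₁ i₂| ^ 2) := by
          nlinarith [sq_nonneg (|Δ i₁ j| - |Δ i₂ j|), sq_nonneg (|Δ i₁ j| - |Δ i₁ i₂|),
            sq_nonneg (|Δ i₂ j| - |Δ i₁ i₂|)]
      _ = _ := by simp only [sq_abs]
  calc ∑ j, geoDist (w j) (orth Q (y j)) ^ 2
      ≤ ∑ j, 48 * (Δ i₁ j ^ 2 + Δ i₂ j ^ 2 + Δ i₁ i₂ ^ 2) := Finset.sum_le_sum fun j _ => h1 j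
    _ = 48 * (R i₁ + R i₂ + k * Δ i₁ i₂ ^ 2) := by
        rw [← Finset.mul_sum, Finset.sum_add_distrib, Finset.sum_add_distrib, Finset.sum_const,
          Finset.card_univ, hcard, nsmul_eq_mul]
    -- `48 * (1 + 32 + 32) = 3120 ≤ 56 ^ 2`.
    _ ≤ (56 * H) ^ 2 * k := by
        nlinarith [mul_le_mul_of_nonneg_left hD hk0.le, mul_nonneg (sq_nonneg H) hk0.le]

/-! ### Initial localization -/

/-- Row `i` of the two distance matrices contains the same values in two orders, so the
rearrangement bound applies. Replacing `f (x i) (x j)` by `f (y i) (y j)` costs `2 * cL * τ + 2 *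
τ`, and the slack in the monotonicity of `f` costs one more `τ`. -/
theorem geoDist_row_lower {cl cL ce : ℝ} {n : ℕ} {f : Circle → Circle → ℝ}
    (hf : IsBiLipschitz cl cL ce n f) (hcL : 0 ≤ cL) {ι : Type*} [Fintype ι] {k : ℕ} [NeZero k]
    {w y x : ι → Circle} (hw : w ∈ regularTuples ι k) (hy : y ∈ regularTuples ι k) {τ : ℝ}
    (hs : slack ce n ≤ τ) (hx : ∀ j, geoDist (x j) (y j) ≤ τ) {F : ι → ι → ℝ}
    (hF : ∀ i j, i ≠ j → f (x i) (x j) = F i j) (i : ι) :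
    cl / 2 * ∑ j, (geoDist (w i) (w j) - geoDist (y i) (y j)) ^ 2
        - (2 * cL + 3) * τ * ∑ j, |geoDist (w i) (w j) - geoDist (y i) (y j)|
      ≤ ∑ j, F i j * (geoDist (w i) (w j) - geoDist (y i) (y j)) := by
  obtain ⟨σ, hσ⟩ := exists_perm_geoDist hy hw (mem_grid_of_regular hy i) (mem_grid_of_regular hw i)
  have h1 := hf.sum_mul_ge (p := y i) (v := y) (a := fun j => geoDist (y i) (y j))
    (b := fun j => geoDist (w i) (w j)) (g := F i) (e := fun _ => 2 * cL * τ + 2 * τ)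
    -- The diagonal of `F` is not given by `f`, but both distances vanish there, so such `j` are
    -- excluded by `hj`.
    (fun _ => rfl) σ hσ (fun j hj => by
      have hij : i ≠ j := by
        rintro rfl
        simp [geoDist_self] at hj
      rw [← hF i j hij]
      refine (hf.abs_sub_le _ _ _ _).trans ?_
      nlinarith [hx i, hx j])
  refine le_trans ?_ h1
  rw [← Finset.mul_sum]
  gcongr
  linarith

/-- The constant in the Frobenius bound on the initial localization. -/
noncomputable def initConst (cl cL : ℝ) : ℝ := 2 * (2 * cL + 4) / cl

/-- The constant in the uniform bound on the refined localization. -/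
noncomputable def refineConst (cl cL : ℝ) : ℝ :=
  128 * (cL * (2 + 56 * initConst cl cL) + 4) / cl + 1

theorem le_of_quadratic {c g q m : ℝ} (hc : 0 < c) (hg : 0 ≤ g) (hq : 0 ≤ q) (hm : 0 ≤ m)
    (h : c / 2 * q ≤ g * m * Real.sqrt q) : q ≤ (2 * g / c) ^ 2 * m ^ 2 := by
  have h1 := Real.sqrt_nonneg q
  have h2 := Real.sq_sqrt hq
  have h3 : Real.sqrt q ≤ 2 * g / c * m := by
    by_contra! h4
    have h5 : 0 < Real.sqrt q := lt_of_le_of_lt (by positivity) h4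
    have h6 : 2 * g / c * m = (2 * g * m) / c := by ring
    rw [h6, div_lt_iff₀ hc] at h4
    nlinarith
  calc q = Real.sqrt q ^ 2 := h2.symm
    _ ≤ (2 * g / c * m) ^ 2 := by gcongr
    _ = _ := by ring

theorem sum_abs_le_sqrt {ι : Type*} (s : Finset ι) (u : ι → ℝ) :
    ∑ j ∈ s, |u j| ≤ Real.sqrt s.card * Real.sqrt (∑ j ∈ s, u j ^ 2) := by
  rw [← Real.sqrt_mul (Nat.cast_nonneg _)]
  refine Real.le_sqrt_of_sq_le ?_
  have h1 := sq_sum_le_card_mul_sum_sq (s := s) (f := fun j => |u j|)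
  simpa only [sq_abs] using h1

theorem sum_sum_abs_le_sqrt {ι : Type*} [Fintype ι] (u : ι → ι → ℝ) :
    ∑ i, ∑ j, |u i j| ≤ Fintype.card ι * Real.sqrt (∑ i, ∑ j, u i j ^ 2) := by
  have h := sum_abs_le_sqrt (Finset.univ : Finset (ι × ι)) (fun p => u p.1 p.2)
  rw [Finset.card_univ, Fintype.card_prod, Fintype.sum_prod_type, Fintype.sum_prod_type,
    Nat.cast_mul, Real.sqrt_mul_self (Nat.cast_nonneg _)] at h
  exact h

/-- Minimality bounds the signal term by the noise term, while the summed row bounds make the signal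
at least quadratic in the Frobenius distance. All errors are linear in that distance: `2 * cL + 3`
from the rows and 1 from the noise. -/
theorem frobenius_le_of_initialCriterion_le {cl cL ce : ℝ} {n : ℕ} {f : Circle → Circle → ℝ}
    (hf : IsBiLipschitz cl cL ce n f) (hcl : 0 < cl) (hcL : 0 ≤ cL) {ι : Type*} [Fintype ι] {k : ℕ}
    [NeZero k] {w y x : ι → Circle} (hw : w ∈ regularTuples ι k) (hy : y ∈ regularTuples ι k)
    {τ : ℝ} (hτ : 0 ≤ τ) (hs : slack ce n ≤ τ) (hx : ∀ j, geoDist (x j) (y j) ≤ τ)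
    {A F : ι → ι → ℝ} (hF : ∀ i j, i ≠ j → f (x i) (x j) = F i j)
    (hmin : initialCriterion A w ≤ initialCriterion A y)
    (hnoise : ∑ i, ∑ j, (A i j - F i j) * (geoDist (y i) (y j) - geoDist (w i) (w j))
      ≤ τ * k * Real.sqrt (∑ i, ∑ j, (geoDist (y i) (y j) - geoDist (w i) (w j)) ^ 2)) :
    ∑ i, ∑ j, (geoDist (w i) (w j) - geoDist (y i) (y j)) ^ 2
      ≤ (initConst cl cL * τ) ^ 2 * k ^ 2 := by
  set Δ : ι → ι → ℝ := fun i j => geoDist (w i) (w j) - geoDist (y i) (y j) with hΔ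
  have h1 := Finset.sum_le_sum fun i (_ : i ∈ Finset.univ) => geoDist_row_lower hf hcL hw hy hs hx hF i
  rw [Finset.sum_sub_distrib, ← Finset.mul_sum, ← Finset.mul_sum] at h1
  have h2 : ∑ i, ∑ j, (A i j - F i j) * (geoDist (y i) (y j) - geoDist (w i) (w j))
      = initialCriterion A y - initialCriterion A w + ∑ i, ∑ j, F i j * Δ i j := by
    unfold initialCriterion
    rw [← Finset.sum_sub_distrib, ← Finset.sum_add_distrib]
    refine Finset.sum_congr rfl fun i _ => ?_
    rw [← Finset.sum_sub_distrib, ← Finset.sum_add_distrib]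
    refine Finset.sum_congr rfl fun j _ => ?_
    simp only [hΔ]; ring
  have h3 : ∑ i, ∑ j, (geoDist (y i) (y j) - geoDist (w i) (w j)) ^ 2 = ∑ i, ∑ j, Δ i j ^ 2 :=
    Finset.sum_congr rfl fun i _ => Finset.sum_congr rfl fun j _ => by simp only [hΔ]; ring
  have h4 := sum_sum_abs_le_sqrt Δ
  rw [card_of_regular hw] at h4
  rw [h3] at hnoise
  have h5 : (2 * cL + 3) * τ * ∑ i, ∑ j, |Δ i j|
      ≤ (2 * cL + 3) * τ * (k * Real.sqrt (∑ i, ∑ j, Δ i j ^ 2)) := by gcongr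
  have h6 := le_of_quadratic (c := cl) (g := (2 * cL + 4) * τ) (q := ∑ i, ∑ j, Δ i j ^ 2)
    (m := k) hcl (by positivity) (Finset.sum_nonneg fun i _ => Finset.sum_nonneg fun j _ =>
      sq_nonneg _) (Nat.cast_nonneg _) (by
        have h7 : ∑ i, ∑ j, F i j * (geoDist (w i) (w j) - geoDist (y i) (y j))
          = ∑ i, ∑ j, F i j * Δ i j := rfl
        linarith)
  refine h6.trans (le_of_eq ?_)
  unfold initConst; ring

/-! ### Refinement -/

/-- The minimizer is compared with a grid point `z₀` near the target `orth Q p`. Only the average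
error of the initial localization enters, since each term of the sum is changed by at most `D =
geoDist z z₀`. -/
theorem geoDist_refine_le {cl cL ce : ℝ} {n : ℕ} {f : Circle → Circle → ℝ}
    (hf : IsBiLipschitz cl cL ce n f) (hcl : 0 < cl) (hcL : 0 ≤ cL) {ι : Type*} [Fintype ι] {k : ℕ}
    [NeZero k] (hk : 8 ≤ k) {w x : ι → Circle} (hw : w ∈ regularTuples ι k) {τ : ℝ} (hτ : 0 ≤ τ)
    (hs : slack ce n ≤ τ) (hkτ : 2 * Real.pi / k ≤ τ) (Q : ℂ ≃ₗᵢ[ℝ] ℂ)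
    (hQ : ∑ j, geoDist (w j) (orth Q (x j)) ≤ (56 * initConst cl cL + 1) * τ * k)
    {p z : Circle} {A F : ι → ℝ} (hF : ∀ j, f p (x j) = F j) (hz : z ∈ grid k)
    (hmin : IsMinOn (fun z => ∑ j, A j * geoDist z (w j)) (grid k) z)
    (hnoise : ∀ z' ∈ grid k, ∑ j, (A j - F j) * (geoDist z' (w j) - geoDist z (w j))
      ≤ τ * Real.sqrt k * Real.sqrt (∑ j, (geoDist z' (w j) - geoDist z (w j)) ^ 2)) :
    geoDist z (orth Q p) ≤ refineConst cl cL * τ := by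
  have hk0 : (0 : ℝ) < k := by exact_mod_cast Nat.pos_of_ne_zero (NeZero.ne k)
  obtain ⟨z₀, hz₀, hz₀'⟩ := exists_mem_grid_geoDist_le k (orth Q p)
  obtain ⟨σ, hσ⟩ := exists_perm_geoDist hw hw hz₀ hz
  set D := geoDist z z₀ with hD
  have hD0 : 0 ≤ D := geoDist_nonneg _ _
  set u : ι → ℝ := fun j => geoDist z (w j) - geoDist z₀ (w j) with hu
  have huD : ∀ j, |u j| ≤ D := fun j => abs_geoDist_sub_le _ _ _
  -- `f` need not be invariant under isometries, so it is evaluated after pulling the estimated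
  -- configuration back by `Q`; the distances do not change.
  have h1 := hf.sum_mul_ge (p := orth Q.symm z₀) (v := fun j => orth Q.symm (w j))
    (a := fun j => geoDist z₀ (w j)) (b := fun j => geoDist z (w j)) (g := F)
    (e := fun j => cL * (τ + geoDist (w j) (orth Q (x j))) + 2 * τ)
    (fun j => (geoDist_orth _ _ _).symm) σ hσ (fun j _ => by
      rw [← hF j]
      refine (hf.abs_sub_le _ _ _ _).trans ?_
      rw [← geoDist_orth Q p, ← geoDist_orth Q (x j), orth_orth_symm, orth_orth_symm,
        geoDist_comm _ (w j)]
      have : geoDist (orth Q p) z₀ ≤ τ := hz₀'.trans hkτ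
      gcongr)
  have hcard := card_of_regular hw
  have h2 : ∑ j, (cL * (τ + geoDist (w j) (orth Q (x j))) + 2 * τ + slack ce n) * |u j|
      ≤ (cL * (2 + 56 * initConst cl cL) + 3) * τ * k * D := by
    calc _ ≤ ∑ j, (cL * (τ + geoDist (w j) (orth Q (x j))) + 3 * τ) * D := by
          refine Finset.sum_le_sum fun j _ => ?_
          have := geoDist_nonneg (w j) (orth Q (x j))
          refine mul_le_mul (by linarith) (huD j) (abs_nonneg _) (by positivity)
      _ = (cL * (τ * k + ∑ j, geoDist (w j) (orth Q (x j))) + 3 * τ * k) * D := by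
          rw [← Finset.sum_mul, Finset.sum_add_distrib, ← Finset.mul_sum, Finset.sum_add_distrib]
          simp only [Finset.sum_const, Finset.card_univ, hcard, nsmul_eq_mul]
          ring
      _ ≤ (cL * (τ * k + (56 * initConst cl cL + 1) * τ * k) + 3 * τ * k) * D := by gcongr
      _ = _ := by ring
  have h3 : ∑ j, F j * u j ≤ τ * k * D := by
    have h4 := hnoise z₀ hz₀
    have h5 : ∑ j, A j * geoDist z (w j) ≤ ∑ j, A j * geoDist z₀ (w j) := hmin hz₀
    have h6 : ∑ j, (geoDist z₀ (w j) - geoDist z (w j)) ^ 2 ≤ D ^ 2 * k := by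
      calc _ ≤ ∑ j : ι, D ^ 2 := by
            refine Finset.sum_le_sum fun j _ => ?_
            have := abs_le.1 (huD j)
            simp only [hu] at this
            exact sq_le_sq' (by linarith) (by linarith)
        _ = _ := by rw [Finset.sum_const, Finset.card_univ, hcard, nsmul_eq_mul, mul_comm]
    have h7 : Real.sqrt (∑ j, (geoDist z₀ (w j) - geoDist z (w j)) ^ 2) ≤ D * Real.sqrt k := by
      refine (Real.sqrt_le_sqrt h6).trans (le_of_eq ?_)
      rw [Real.sqrt_mul (sq_nonneg _), Real.sqrt_sq hD0]
    have h8 : ∑ j, (A j - F j) * (geoDist z₀ (w j) - geoDist z (w j))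
        = ∑ j, A j * geoDist z₀ (w j) - ∑ j, A j * geoDist z (w j) + ∑ j, F j * u j := by
      rw [← Finset.sum_sub_distrib, ← Finset.sum_add_distrib]
      refine Finset.sum_congr rfl fun j _ => ?_
      simp only [hu]; ring
    calc ∑ j, F j * u j ≤ τ * Real.sqrt k * Real.sqrt (∑ j, (geoDist z₀ (w j) - geoDist z (w j)) ^ 2) := by
          linarith
      _ ≤ τ * Real.sqrt k * (D * Real.sqrt k) := by gcongr
      _ = τ * (Real.sqrt k * Real.sqrt k) * D := by ring
      _ = _ := by rw [Real.mul_self_sqrt hk0.le]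
  have h9 := card_mul_geoDist_sq_le hk hw z z₀
  -- Quadratic in `D` on the left, linear on the right; `128 = 2 * 64`, with 64 from
  -- `card_mul_geoDist_sq_le`.
  have h10 : cl * (k * D ^ 2) ≤ 128 * (cL * (2 + 56 * initConst cl cL) + 4) * τ * k * D := by
    have h11 : cl * (k * D ^ 2) ≤ cl * (64 * ∑ j, u j ^ 2) := by gcongr
    have h12 : cl / 2 * ∑ j, u j ^ 2
        - ∑ j, (cL * (τ + geoDist (w j) (orth Q (x j))) + 2 * τ + slack ce n) * |u j|
      ≤ ∑ j, F j * u j := h1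
    linarith
  have hI : 0 ≤ initConst cl cL := by unfold initConst; positivity
  have h13 : D ≤ 128 * (cL * (2 + 56 * initConst cl cL) + 4) / cl * τ := by
    rcases hD0.eq_or_lt with h | h
    · rw [← h]; positivity
    · rw [div_mul_eq_mul_div, le_div_iff₀ hcl]
      have h14 : 0 < k * D := mul_pos hk0 h
      refine le_of_mul_le_mul_right ?_ h14
      linarith
  have h15 := geoDist_triangle z z₀ (orth Q p)
  rw [geoDist_comm z₀] at h15
  unfold refineConst
  linarith

/-! ### Identifiability -/

theorem IsRepresentation.offdiag {n : ℕ} {F : Fin n → Fin n → ℝ} {cl cL ce : ℝ}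
    {x : Fin n → Circle} {f : Circle → Circle → ℝ} (h : IsRepresentation F cl cL ce x f)
    (hF : ∀ i j, F i j = F j i) {i j : Fin n} (hij : i ≠ j) : f (x i) (x j) = F i j := by
  rcases lt_or_gt_of_ne hij with h' | h'
  · exact h.2 i j h'
  · rw [h.1.symm, h.2 j i h', hF]

/-- The row bound is applied twice with the roles of the two regular tuples exchanged. Both
representations share `F`, so the linear terms cancel on adding, and a quadratic is left below a
linear error in every row. Anchors turn this into closeness in mean square, and the row bounds turn
that into a uniform bound. -/
theorem exists_orth_of_representations {cl cL ce : ℝ} {n : ℕ} (hcl : 0 < cl) (hcL : 0 ≤ cL)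
    (hn : 8 ≤ n) {F : Fin n → Fin n → ℝ} (hFs : ∀ i j, F i j = F j i)
    {x x' y y' : Fin n → Circle} {f f' : Circle → Circle → ℝ}
    (hx : IsRepresentation F cl cL ce x f) (hx' : IsRepresentation F cl cL ce x' f')
    (hy : y ∈ regularTuples (Fin n) n) (hy' : y' ∈ regularTuples (Fin n) n) {τ : ℝ} (hτ : 0 ≤ τ)
    (hs : slack ce n ≤ τ) (hxy : ∀ i, geoDist (x i) (y i) ≤ τ)
    (hxy' : ∀ i, geoDist (x' i) (y' i) ≤ τ) :
    ∃ Q : ℂ ≃ₗᵢ[ℝ] ℂ, ∀ i, geoDist (x i) (orth Q (x' i)) ≤ (640 * initConst cl cL + 2) * τ := by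
  have : NeZero n := ⟨by omega⟩
  have hn0 : (0 : ℝ) < n := by exact_mod_cast (by omega : 0 < n)
  set Δ : Fin n → Fin n → ℝ := fun i j => geoDist (y i) (y j) - geoDist (y' i) (y' j) with hΔ
  set I := initConst cl cL with hI
  have hI0 : 0 ≤ I := by rw [hI]; unfold initConst; positivity
  have hrow : ∀ i, ∑ j, Δ i j ^ 2 ≤ (I * τ) ^ 2 * n := by
    intro i
    have h1 := geoDist_row_lower hx.1 hcL hy' hy hs hxy (fun _ _ => hx.offdiag hFs) i
    have h2 := geoDist_row_lower hx'.1 hcL hy hy' hs hxy' (fun _ _ => hx'.offdiag hFs) i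
    have h3 : ∀ j, geoDist (y' i) (y' j) - geoDist (y i) (y j) = -Δ i j := fun j => by
      simp only [hΔ]; ring
    simp only [h3, neg_sq, abs_neg, mul_neg, Finset.sum_neg_distrib] at h1
    have h4 := sum_abs_le_sqrt Finset.univ (Δ i)
    rw [Finset.card_univ, Fintype.card_fin] at h4
    have h5 : (2 * cL + 3) * τ * ∑ j, |Δ i j|
        ≤ (2 * cL + 4) * τ * (Real.sqrt n * Real.sqrt (∑ j, Δ i j ^ 2)) := by
      gcongr
      norm_num
    have h6 : cl / 2 * ∑ j, Δ i j ^ 2 - (2 * cL + 3) * τ * ∑ j, |Δ i j| ≤ ∑ j, F i j * Δ i j := h2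
    have h7 := le_of_quadratic (c := cl) (g := (2 * cL + 4) * τ) (q := ∑ j, Δ i j ^ 2)
      (m := Real.sqrt n) hcl (by positivity) (Finset.sum_nonneg fun j _ => sq_nonneg _)
      (Real.sqrt_nonneg _) (by linarith)
    rw [Real.sq_sqrt hn0.le] at h7
    refine h7.trans (le_of_eq ?_)
    rw [hI]; unfold initConst; ring
  obtain ⟨Q, hQ⟩ := exists_orth_sum_sq_le hn hy hy' (H := I * τ) (by
    calc ∑ i, ∑ j, Δ i j ^ 2 ≤ ∑ i : Fin n, (I * τ) ^ 2 * n := Finset.sum_le_sum fun i _ => hrow i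
      _ = (I * τ) ^ 2 * n ^ 2 := by
        rw [Finset.sum_const, Finset.card_univ, Fintype.card_fin, nsmul_eq_mul]; ring)
  refine ⟨Q, fun i => ?_⟩
  have h1 := card_mul_geoDist_sq_le hn hy (y i) (orth Q (y' i))
  have h2 : ∑ j, (geoDist (y i) (y j) - geoDist (orth Q (y' i)) (y j)) ^ 2
      ≤ 2 * ((I * τ) ^ 2 * n + (56 * (I * τ)) ^ 2 * n) := by
    calc _ ≤ ∑ j, 2 * (Δ i j ^ 2 + geoDist (y j) (orth Q (y' j)) ^ 2) := by
          refine Finset.sum_le_sum fun j _ => ?_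
          have h3 := abs_geoDist_sub_le (y j) (orth Q (y' j)) (orth Q (y' i))
          rw [geoDist_orth, geoDist_comm (y j) (orth Q (y' i)), geoDist_comm (y' j)] at h3
          have h4 := sq_le_sq' (abs_le.1 h3).1 (abs_le.1 h3).2
          have h5 : geoDist (y i) (y j) - geoDist (orth Q (y' i)) (y j)
              = Δ i j - (geoDist (orth Q (y' i)) (y j) - geoDist (y' i) (y' j)) := by
            simp only [hΔ]; ring
          rw [h5]
          nlinarith [sq_nonneg (Δ i j + (geoDist (orth Q (y' i)) (y j) - geoDist (y' i) (y' j)))]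
      _ ≤ _ := by
          rw [← Finset.mul_sum, Finset.sum_add_distrib]
          linarith [hrow i]
  -- `64 * 2 * (1 + 56 ^ 2) = 401536 ≤ 640 ^ 2`.
  have h6 : geoDist (y i) (orth Q (y' i)) ≤ 640 * (I * τ) := by
    refine (abs_le_of_sq_le_sq' ?_ (by positivity)).2
    refine le_of_mul_le_mul_left ?_ hn0
    nlinarith [mul_nonneg (sq_nonneg (I * τ)) hn0.le]
  have h7 := geoDist_triangle (x i) (y i) (orth Q (x' i))
  have h8 := geoDist_triangle (y i) (orth Q (y' i)) (orth Q (x' i))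
  rw [geoDist_orth, geoDist_comm (y' i)] at h8
  linarith [hxy i, hxy' i]

/-! ### Merging -/

/-- An isometry that almost fixes at least half of the points of an almost regular tuple is close to
the identity. -/
theorem geoDist_orth_self_le {n : ℕ} (hn : 16 ≤ n) {x y : Fin n → Circle}
    (hy : y ∈ regularTuples (Fin n) n) {η ρ : ℝ} (hη : 0 ≤ η) (hxy : ∀ i, geoDist (x i) (y i) ≤ η)
    {R : Finset (Fin n)} (hR : n ≤ 2 * R.card) {P : ℂ ≃ₗᵢ[ℝ] ℂ}
    (hP : ∀ i ∈ R, geoDist (orth P (x i)) (x i) ≤ ρ) (z : Circle) :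
    geoDist (orth P z) z ≤ 8 * ρ + 16 * η := by
  have : NeZero n := ⟨by omega⟩
  obtain ⟨a, ha | ha⟩ := orth_cases P
  -- A rotation moves all points by the same amount, so one point of `R` suffices.
  · obtain ⟨i, hi⟩ : R.Nonempty := by rw [← Finset.card_pos]; omega
    have h1 := hP i hi
    have h2 : ∀ z, geoDist (a * z) z = geoDist a 1 := fun z => by
      conv_lhs => rw [mul_comm, show geoDist (z * a) z = geoDist (z * a) (z * 1) by rw [mul_one]]
      exact geoDist_mul_left _ _ _
    rw [ha, h2] at h1 ⊢
    have := geoDist_nonneg a 1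
    linarith
  · obtain ⟨τ, hτ⟩ := exists_equiv_gridPoint hy
    set q := n / 8 with hq
    -- Otherwise `R` and its shifts by `q` and `2 * q` would be pairwise disjoint, which is
    -- impossible for a set containing half of the points.
    obtain ⟨i, hi, j, hj, hij⟩ : ∃ i ∈ R, ∃ j ∈ R,
        Real.pi / 8 ≤ geoDist (y i) (y j) ∧ geoDist (y i) (y j) ≤ Real.pi / 2 := by
      by_contra! hno
      set ρ₁ : Equiv.Perm (Fin n) := τ.trans ((Equiv.addRight (q : ZMod n)).trans τ.symm) with hρ₁
      have hsep1 : ∀ i, Real.pi / 8 ≤ geoDist (y i) (y (ρ₁ i)) ∧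
          geoDist (y i) (y (ρ₁ i)) ≤ Real.pi / 2 := by
        intro i
        have h := geoDist_shift_mem (k := n) (q := q) (by omega) (by omega) (τ i)
        have h' : y (ρ₁ i) = gridPoint n (τ i + q) := by rw [hτ]; simp [hρ₁]
        rwa [← h', ← hτ] at h
      have hsep2 : ∀ i, Real.pi / 8 ≤ geoDist (y i) (y (ρ₁ (ρ₁ i))) ∧
          geoDist (y i) (y (ρ₁ (ρ₁ i))) ≤ Real.pi / 2 := by
        intro i
        have h := geoDist_shift_mem (k := n) (q := 2 * q) (by omega) (by omega) (τ i)
        have h' : y (ρ₁ (ρ₁ i)) = gridPoint n (τ i + ((2 * q : ℕ) : ZMod n)) := by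
          rw [hτ]
          simp only [hρ₁, Equiv.trans_apply, Equiv.apply_symm_apply, Equiv.coe_addRight]
          congr 1; push_cast; ring
        rwa [← h', ← hτ] at h
      have hd1 : Disjoint R (R.map ρ₁.toEmbedding) := by
        rw [Finset.disjoint_left]
        intro j hj hj'
        obtain ⟨i, hi, rfl⟩ := Finset.mem_map.1 hj'
        exact absurd (hsep1 i).2 (not_le.2 (hno i hi _ hj (hsep1 i).1))
      have hd2 : Disjoint R ((R.map ρ₁.toEmbedding).map ρ₁.toEmbedding) := by
        rw [Finset.disjoint_left]
        intro j hj hj'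
        obtain ⟨i', hi', rfl⟩ := Finset.mem_map.1 hj'
        obtain ⟨i, hi, rfl⟩ := Finset.mem_map.1 hi'
        exact absurd (hsep2 i).2 (not_le.2 (hno i hi _ hj (hsep2 i).1))
      have hd3 : Disjoint (R.map ρ₁.toEmbedding) ((R.map ρ₁.toEmbedding).map ρ₁.toEmbedding) :=
        (Finset.disjoint_map _).2 hd1
      have h1 := Finset.card_le_univ (R ∪ (R.map ρ₁.toEmbedding ∪
        (R.map ρ₁.toEmbedding).map ρ₁.toEmbedding))
      rw [Finset.card_union_of_disjoint (Finset.disjoint_union_right.2 ⟨hd1, hd2⟩),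
        Finset.card_union_of_disjoint hd3, Finset.card_map, Finset.card_map, Fintype.card_fin] at h1
      simp only [Finset.card_map] at h1
      omega
    have hsq : ∀ i ∈ R, geoDist a (x i * x i) ≤ ρ := by
      intro i hi
      have h1 := hP i hi
      rw [ha, ← geoDist_mul_left (x i), mul_comm (x i) (a * _), mul_assoc, inv_mul_cancel,
        mul_one] at h1
      exact h1
    have hdbl : ∀ i, geoDist (x i * x i) (y i * y i) ≤ 2 * η := by
      intro i
      have h1 := geoDist_triangle (x i * x i) (x i * y i) (y i * y i)
      rw [geoDist_mul_left, mul_comm (x i) (y i), geoDist_mul_left] at h1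
      linarith [hxy i]
    have h1 := geoDist_sq_eq hij.2
    have h2 := geoDist_triangle (y i * y i) (x i * x i) (y j * y j)
    have h3 := geoDist_triangle (x i * x i) (x j * x j) (y j * y j)
    have h4 := geoDist_triangle (x i * x i) a (x j * x j)
    rw [geoDist_comm (y i * y i) (x i * x i)] at h2
    rw [geoDist_comm (x i * x i) a] at h4
    -- A reflection is not excluded outright: near-fixed `x i` and `x j` have squares near `a`,
    -- whereas the squares of `y i` and `y j` are at least `π / 4` apart. Hence `π / 4 ≤ 2 * ρ + 4 *
    -- η`, and the claimed bound is at least `π`.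
    have := geoDist_le_pi (orth P z) z
    linarith [hsq i hi, hsq j hj, hdbl i, hdbl j, hij.1]

/-! ### The Localize-and-Refine procedure on a favourable event -/

/-- The noise does not perturb the initial criterion, on the index set `s`, by more than `τ`. -/
def InitialNoiseBound {n : ℕ} (k : ℕ) (E : Fin n → Fin n → ℝ) (s : Finset (Fin n)) (τ : ℝ) : Prop :=
  ∀ w ∈ regularTuples s k, ∀ y ∈ regularTuples s k,
    ∑ i : s, ∑ j : s, E i j * (geoDist (y i) (y j) - geoDist (w i) (w j))
      ≤ τ * k * Real.sqrt (∑ i : s, ∑ j : s, (geoDist (y i) (y j) - geoDist (w i) (w j)) ^ 2)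

/-- The noise does not perturb the refinement criterion, for the initial localization `w` on `s`, by
more than `τ`. -/
def RefineNoiseBound {n : ℕ} (k : ℕ) (E : Fin n → Fin n → ℝ) (s : Finset (Fin n)) (w : s → Circle)
    (τ : ℝ) : Prop :=
  ∀ i ∉ s, ∀ z ∈ grid k, ∀ z' ∈ grid k,
    ∑ j : s, E i j * (geoDist z' (w j) - geoDist z (w j))
      ≤ τ * Real.sqrt k * Real.sqrt (∑ j : s, (geoDist z' (w j) - geoDist z (w j)) ^ 2)

/-- The restriction to `s` of the tuple `y` is close to a regular tuple. -/
def WellSampled {n : ℕ} (k : ℕ) (y : Fin n → Circle) (s : Finset (Fin n)) (τ : ℝ) : Prop :=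
  ∃ v ∈ regularTuples s k, ∀ j : s, geoDist (y j) (v j) ≤ τ

theorem initConst_nonneg {cl cL : ℝ} (hcl : 0 < cl) (hcL : 0 ≤ cL) : 0 ≤ initConst cl cL := by
  unfold initConst; positivity

theorem refineConst_nonneg {cl cL : ℝ} (hcl : 0 < cl) (hcL : 0 ≤ cL) :
    0 ≤ refineConst cl cL := by
  have := initConst_nonneg hcl hcL
  unfold refineConst; positivity

/-- The isometry comes from the initial localization alone, so the same one serves every refinement
and every index outside the sample. -/
theorem exists_orth_refinement {cl cL ce : ℝ} {n k : ℕ} (hcl : 0 < cl) (hcL : 0 ≤ cL) (hk : 8 ≤ k)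
    {A F : Fin n → Fin n → ℝ} (hF : ∀ i j, F i j = F j i) {x : Fin n → Circle}
    {f : Circle → Circle → ℝ} (hx : IsRepresentation F cl cL ce x f) {τ : ℝ} (hτ : 0 ≤ τ)
    (hs : slack ce n ≤ τ) (hkτ : 2 * Real.pi / k ≤ τ) {s : Finset (Fin n)} (hcard : s.card = k)
    {loc : (T : Finset (Fin n)) → (T → T → ℝ) → T → Circle} (hloc : IsInitialRule k loc)
    (hws : WellSampled k x s τ)
    (h1 : InitialNoiseBound k (fun i j => A i j - F i j) s τ)
    (h2 : RefineNoiseBound k (fun i j => A i j - F i j) s (loc s (sub A s)) τ) :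
    ∃ Q : ℂ ≃ₗᵢ[ℝ] ℂ, ∀ x₂, IsRefinement k A s (loc s (sub A s)) x₂ →
      ∀ i ∉ s, geoDist (x₂ i) (orth Q (x i)) ≤ refineConst cl cL * τ := by
  have : NeZero k := ⟨by omega⟩
  obtain ⟨v, hv, hxv⟩ := hws
  set w := loc s (sub A s)
  have hw : w ∈ regularTuples s k := hloc.mem s hcard _
  have hcr : initialCriterion (sub A s) w ≤ initialCriterion (sub A s) v :=
    hloc.isMin s hcard (sub A s) hv
  have hfro := frobenius_le_of_initialCriterion_le hx.1 hcl hcL hw hv hτ hs (x := fun j : s => x j)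
    hxv (A := sub A s) (F := sub F s)
    (fun i j hij => hx.offdiag hF (fun h => hij (Subtype.ext h))) hcr (h1 w hw v hv)
  obtain ⟨Q, hQ⟩ := exists_orth_sum_sq_le hk hw hv hfro
  have hI := initConst_nonneg hcl hcL
  have hc : Fintype.card s = k := card_of_regular hw
  have hl1 := sum_abs_le_of_sum_sq_le (u := fun j => geoDist (w j) (orth Q (v j)))
    (H := 56 * (initConst cl cL * τ)) (by positivity) (by rw [hc]; exact hQ)
  simp only [abs_of_nonneg (geoDist_nonneg _ _), hc] at hl1
  refine ⟨Q, fun x₂ hx₂ i hi => ?_⟩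
  refine geoDist_refine_le hx.1 hcl hcL hk hw hτ hs hkτ Q (x := fun j : s => x j) ?_
    (A := fun j => A i j) (F := fun j => F i j) (fun j => hx.offdiag hF ?_) (hx₂ i hi).1 (hx₂ i hi).2
    (fun z' hz' => h2 i hi _ (hx₂ i hi).1 z' hz')
  · calc ∑ j, geoDist (w j) (orth Q (x j)) ≤ ∑ j, (geoDist (w j) (orth Q (v j)) + τ) := by
          refine Finset.sum_le_sum fun j _ => ?_
          have h3 := geoDist_triangle (w j) (orth Q (v j)) (orth Q (x j))
          rw [geoDist_orth, geoDist_comm (v j)] at h3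
          linarith [hxv j]
      _ ≤ _ := by
          rw [Finset.sum_add_distrib, Finset.sum_const, Finset.card_univ, hc, nsmul_eq_mul]
          linarith
  · rintro rfl
    exact hi j.2

theorem exists_orth_output {cl cL ce : ℝ} {n k : ℕ} (hcl : 0 < cl) (hcL : 0 ≤ cL) (hk : 8 ≤ k)
    (hn : n = 4 * k) {A F : Fin n → Fin n → ℝ} (hF : ∀ i j, F i j = F j i) {x y : Fin n → Circle}
    {f : Circle → Circle → ℝ} (hx : IsRepresentation F cl cL ce x f)
    (hy : y ∈ regularTuples (Fin n) n) {τ : ℝ} (hτ : 0 ≤ τ)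
    (hs : slack ce n ≤ τ) (hkτ : 2 * Real.pi / k ≤ τ) (hxy : ∀ i, geoDist (x i) (y i) ≤ τ)
    {s s' : Finset (Fin n)} (hcard : s.card = k) (hcard' : s'.card = k) (hdisj : Disjoint s s')
    {loc loc' : (T : Finset (Fin n)) → (T → T → ℝ) → T → Circle} (hloc : IsInitialRule k loc)
    (hloc' : IsInitialRule k loc')
    (hws : WellSampled k x s τ) (hws' : WellSampled k x s' τ)
    (h1 : InitialNoiseBound k (fun i j => A i j - F i j) s τ)
    (h1' : InitialNoiseBound k (fun i j => A i j - F i j) s' τ)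
    (h2 : RefineNoiseBound k (fun i j => A i j - F i j) s (loc s (sub A s)) τ)
    (h2' : RefineNoiseBound k (fun i j => A i j - F i j) s' (loc' s' (sub A s')) τ)
    {xhat : Fin n → Circle} (hout : IsOutput k loc loc' A s s' xhat) :
    ∃ Q : ℂ ≃ₗᵢ[ℝ] ℂ, ∀ i, geoDist (xhat i) (orth Q (x i))
      ≤ (33 * refineConst cl cL + 16) * τ := by
  obtain ⟨Q, hQ⟩ := exists_orth_refinement hcl hcL hk hF hx hτ hs hkτ hcard hloc hws h1 h2
  obtain ⟨Q', hQ'⟩ := exists_orth_refinement hcl hcL hk hF hx hτ hs hkτ hcard' hloc' hws' h1' h2'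
  obtain ⟨x₂, x₂', Qm, hx₂, hx₂', hmin, hxS, hxS'⟩ := hout
  replace hQ := hQ x₂ hx₂
  replace hQ' := hQ' x₂' hx₂'
  set B := refineConst cl cL * τ with hB
  have hB0 : 0 ≤ B := mul_nonneg (refineConst_nonneg hcl hcL) hτ
  set R : Finset (Fin n) := (s ∪ s')ᶜ with hR
  have hRcard : n ≤ 2 * R.card := by
    rw [hR, Finset.card_compl, Finset.card_union_of_disjoint hdisj, Fintype.card_fin, hcard, hcard']
    omega
  have hmerge : mergeCriterion s s' x₂ x₂' Qm ≤ 2 * B := by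
    -- This competitor undoes the second alignment and applies the first; the chosen merge can only
    -- do better.
    refine (hmin (Q'.symm.trans Q)).trans ?_
    refine Real.iSup_le (fun i => ?_) (by linarith)
    have h3 := geoDist_triangle (x₂ i) (orth Q (x i)) (orth (Q'.symm.trans Q) (x₂' i))
    have h4 : geoDist (orth Q (x i)) (orth (Q'.symm.trans Q) (x₂' i))
        = geoDist (x₂' i) (orth Q' (x i)) := by
      rw [orth_trans, geoDist_orth, ← geoDist_orth Q', orth_orth_symm, geoDist_comm]
    linarith [hQ i i.2.1, hQ' i i.2.2]
  have hP : ∀ i ∈ R, geoDist (orth ((Q'.trans Qm).trans Q.symm) (x i)) (x i) ≤ 4 * B := by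
    intro i hi
    simp only [hR, Finset.mem_compl, Finset.mem_union, not_or] at hi
    have h3 : geoDist (x₂ i) (orth Qm (x₂' i)) ≤ mergeCriterion s s' x₂ x₂' Qm :=
      le_ciSup (f := fun i : {i : Fin n // i ∉ s ∧ i ∉ s'} => geoDist (x₂ i) (orth Qm (x₂' i)))
        (Set.finite_range _).bddAbove ⟨i, hi⟩
    rw [orth_trans, orth_trans, ← geoDist_orth Q, orth_orth_symm]
    have h4 := geoDist_triangle (orth Qm (orth Q' (x i))) (orth Qm (x₂' i)) (orth Q (x i))
    have h5 := geoDist_triangle (orth Qm (x₂' i)) (x₂ i) (orth Q (x i))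
    rw [geoDist_orth, geoDist_comm _ (x₂' i)] at h4
    rw [geoDist_comm _ (x₂ i)] at h5
    linarith [hQ i hi.1, hQ' i hi.2]
  -- Displacement at most `8 * (4 * B) + 16 * τ`; adding the error `B` of the second refinement
  -- gives `33 * B + 16 * τ`.
  have hclose := geoDist_orth_self_le (by omega) hy hτ hxy hRcard hP
  refine ⟨Q, fun i => ?_⟩
  by_cases hi : i ∈ s
  · rw [hxS' i hi]
    have h3 := geoDist_triangle (orth Qm (x₂' i)) (orth Qm (orth Q' (x i))) (orth Q (x i))
    have h4 := hclose (x i)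
    rw [orth_trans, orth_trans, ← geoDist_orth Q, orth_orth_symm] at h4
    rw [geoDist_orth] at h3
    linarith [hQ' i (Finset.disjoint_left.1 hdisj hi)]
  · rw [hxS i hi]
    linarith [hQ i hi]

/-! ### Concentration of a uniform random subset of fixed size -/

/-- The binomial distribution of parameters `4 * k` and `1 / 4` has mode `k`. -/
theorem choose_mul_pow_le_mode {k j : ℕ} :
    ((4 * k).choose j : ℝ) * (1 / 3) ^ j ≤ (4 * k).choose k * (1 / 3) ^ k := by
  have step : ∀ m : ℕ, ((4 * k).choose (m + 1) : ℝ) * (1 / 3) ^ (m + 1) * (3 * (m + 1))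
      = (4 * k).choose m * (1 / 3) ^ m * ((4 * k - m : ℕ) : ℝ) := by
    intro m
    have h : ((4 * k).choose (m + 1) : ℝ) * (m + 1) = (4 * k).choose m * ((4 * k - m : ℕ) : ℝ) := by
      exact_mod_cast Nat.choose_succ_right_eq (4 * k) m
    calc _ = ((4 * k).choose (m + 1) : ℝ) * (m + 1) * (1 / 3) ^ m := by ring
      _ = _ := by rw [h]; ring
  rcases le_total j k with h | h
  · induction h using Nat.decreasingInduction with
    | self => exact le_rfl
    | of_succ m hm ih =>
      refine le_trans ?_ ih
      have h1 := step m
      have h2 : (3 : ℝ) * (m + 1) ≤ ((4 * k - m : ℕ) : ℝ) := by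
        exact_mod_cast (by omega : 3 * (m + 1) ≤ 4 * k - m)
      have h3 : (0 : ℝ) < 3 * (m + 1) := by positivity
      refine le_of_mul_le_mul_right ?_ h3
      rw [h1]
      gcongr
  · induction j, h using Nat.le_induction with
    | base => exact le_rfl
    | succ m hm ih =>
      refine le_trans ?_ ih
      have h1 := step m
      have h2 : ((4 * k - m : ℕ) : ℝ) ≤ (3 : ℝ) * (m + 1) := by
        exact_mod_cast (by omega : 4 * k - m ≤ 3 * (m + 1))
      have h3 : (0 : ℝ) < 3 * (m + 1) := by positivity
      refine le_of_mul_le_mul_right ?_ h3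
      rw [h1]
      gcongr

/-- The binomial expansion of `(1 / 3 + 1) ^ (4 * k)` has `4 * k + 1` terms, none exceeding the
mode. -/
theorem pow_le_card_mul_mode (k : ℕ) :
    (4 / 3 : ℝ) ^ (4 * k) ≤ (4 * k + 1) * ((4 * k).choose k * (1 / 3) ^ k) := by
  have h := add_pow (1 / 3 : ℝ) 1 (4 * k)
  rw [show (1 / 3 + 1 : ℝ) = 4 / 3 by norm_num] at h
  rw [h]
  calc _ ≤ ∑ m ∈ Finset.range (4 * k + 1), ((4 * k).choose k : ℝ) * (1 / 3) ^ k := by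
        refine Finset.sum_le_sum fun m _ => ?_
        rw [one_pow, mul_one, mul_comm]
        exact choose_mul_pow_le_mode
    _ = _ := by
        rw [Finset.sum_const, Finset.card_range, nsmul_eq_mul]
        push_cast
        ring

/-- A uniform `k`-subset is an independent selection with probability `1 / 4` conditioned on its
size, an event of probability at least `1 / (4 * k + 1)`. The exponential moment is thus at most `4
* k + 1` times that of the independent selection. The weight `1 / 3` in `g` is the odds of being
selected. -/
theorem sum_exp_card_inter_le {ι : Type*} [Fintype ι] [DecidableEq ι] {k : ℕ}
    (hcard : Fintype.card ι = 4 * k) (T : Finset ι) {t : ℝ} (ht : |t| ≤ 1) :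
    ∑ S ∈ Finset.powersetCard k (Finset.univ : Finset ι),
        Real.exp (t * ((S ∩ T).card - (T.card : ℝ) / 4))
      ≤ (4 * k + 1) * (4 * k).choose k * Real.exp (k * t ^ 2) := by
  set g : ι → ℝ := fun i => 1 / 3 * (if i ∈ T then Real.exp t else 1) with hg
  have hg0 : ∀ i, 0 ≤ g i := fun i => by simp only [hg]; split_ifs <;> positivity
  have hprod : ∀ S : Finset ι, ∏ i ∈ S, g i = (1 / 3) ^ S.card * Real.exp (t * (S ∩ T).card) := by
    intro S
    simp only [hg]
    rw [Finset.prod_mul_distrib, Finset.prod_const, Finset.prod_ite_mem, Finset.prod_const,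
      ← Real.exp_nat_mul, mul_comm t]
  have h1 : ∑ S ∈ Finset.powersetCard k (Finset.univ : Finset ι), ∏ i ∈ S, g i
      ≤ ∏ i, (1 + g i) := by
    rw [Finset.prod_one_add]
    refine Finset.sum_le_sum_of_subset_of_nonneg (fun S _ => by simp) fun S _ _ => ?_
    exact Finset.prod_nonneg fun i _ => hg0 i
  have hexp : Real.exp t ≤ 1 + t + t ^ 2 := by
    have := abs_le.1 (Real.abs_exp_sub_one_sub_id_le ht)
    linarith [this.2]
  have h2 : ∏ i, (1 + g i) ≤ (4 / 3) ^ (4 * k) * Real.exp (T.card * ((t + t ^ 2) / 4)) := by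
    calc ∏ i, (1 + g i)
        ≤ ∏ i, (4 / 3 * (if i ∈ T then Real.exp ((t + t ^ 2) / 4) else 1)) := by
          refine Finset.prod_le_prod (fun i _ => by linarith [hg0 i]) fun i _ => ?_
          simp only [hg]
          split_ifs
          · have := Real.add_one_le_exp ((t + t ^ 2) / 4)
            linarith
          · norm_num
      _ = _ := by
          rw [Finset.prod_mul_distrib, Finset.prod_const, Finset.card_univ, hcard,
            Finset.prod_ite_mem, Finset.univ_inter, Finset.prod_const, ← Real.exp_nat_mul]
  have h3 : ∑ S ∈ Finset.powersetCard k (Finset.univ : Finset ι), ∏ i ∈ S, g i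
      = (1 / 3) ^ k * Real.exp (t * T.card / 4)
        * ∑ S ∈ Finset.powersetCard k (Finset.univ : Finset ι),
          Real.exp (t * ((S ∩ T).card - (T.card : ℝ) / 4)) := by
    rw [Finset.mul_sum]
    refine Finset.sum_congr rfl fun S hS => ?_
    rw [hprod, (Finset.mem_powersetCard.1 hS).2, mul_assoc, ← Real.exp_add]
    congr 2
    ring
  have h4 := pow_le_card_mul_mode k
  have hT : (T.card : ℝ) ≤ 4 * k := by
    have := Finset.card_le_univ T
    rw [hcard] at this
    exact_mod_cast this
  have h5 : Real.exp (T.card * ((t + t ^ 2) / 4))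
      ≤ Real.exp (t * T.card / 4) * Real.exp (k * t ^ 2) := by
    rw [← Real.exp_add]
    refine Real.exp_le_exp.2 ?_
    nlinarith [sq_nonneg t]
  have h6 : (0 : ℝ) < (1 / 3) ^ k * Real.exp (t * T.card / 4) := by positivity
  refine le_of_mul_le_mul_left ?_ h6
  rw [← h3]
  calc _ ≤ (4 / 3) ^ (4 * k) * Real.exp (T.card * ((t + t ^ 2) / 4)) := h1.trans h2
    _ ≤ ((4 * k + 1) * ((4 * k).choose k * (1 / 3) ^ k))
        * (Real.exp (t * T.card / 4) * Real.exp (k * t ^ 2)) := by gcongr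
    _ = _ := by ring

open Classical in
theorem card_filter_deviation_le {ι : Type*} [Fintype ι] [DecidableEq ι] {k : ℕ}
    (hcard : Fintype.card ι = 4 * k) (T : Finset ι) {t u : ℝ} (ht0 : 0 ≤ t) (ht : t ≤ 1) :
    (((Finset.powersetCard k (Finset.univ : Finset ι)).filter
        fun S => u < |((S ∩ T).card : ℝ) - (T.card : ℝ) / 4|).card : ℝ)
      ≤ 2 * (4 * k + 1) * (4 * k).choose k * Real.exp (k * t ^ 2 - t * u) := by
  set d : Finset ι → ℝ := fun S => ((S ∩ T).card : ℝ) - (T.card : ℝ) / 4 with hd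
  have h1 := sum_exp_card_inter_le hcard T (t := t) (by rwa [abs_of_nonneg ht0])
  have h2 := sum_exp_card_inter_le hcard T (t := -t) (by rwa [abs_neg, abs_of_nonneg ht0])
  rw [neg_sq] at h2
  have h3 : (((Finset.powersetCard k (Finset.univ : Finset ι)).filter fun S => u < |d S|).card : ℝ)
        * Real.exp (t * u)
      ≤ ∑ S ∈ Finset.powersetCard k (Finset.univ : Finset ι),
          (Real.exp (t * d S) + Real.exp (-t * d S)) := by
    rw [← nsmul_eq_mul, ← Finset.sum_const]
    refine (Finset.sum_le_sum fun S hS => ?_).trans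
      (Finset.sum_le_sum_of_subset_of_nonneg (Finset.filter_subset _ _) fun S _ _ => by positivity)
    have hS' := (Finset.mem_filter.1 hS).2
    rcases abs_cases (d S) with ⟨h, -⟩ | ⟨h, -⟩
    · have : Real.exp (t * u) ≤ Real.exp (t * d S) := by
        rw [h] at hS'
        gcongr
      linarith [Real.exp_pos (-t * d S)]
    · have : Real.exp (t * u) ≤ Real.exp (-t * d S) := by
        rw [h] at hS'
        rw [neg_mul, ← mul_neg]
        gcongr
      linarith [Real.exp_pos (t * d S)]
  rw [Finset.sum_add_distrib] at h3
  rw [Real.exp_sub, ← mul_div_assoc, le_div_iff₀ (Real.exp_pos _)]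
  linarith

/-! ### Sampling an almost regular tuple -/

/-- If the proportion of sampled points is nearly constant on the initial segments of a regular
tuple, then the sample is almost regular. -/
theorem wellSampled_of_prefix {n k : ℕ} (hk : 0 < k) (hn : n = 4 * k) (σ : Fin n ≃ Fin n)
    {y : Fin n → Circle} (hy : ∀ j, y j = Circle.exp (2 * Real.pi * (σ j : ℕ) / n))
    {s : Finset (Fin n)} (hs : s.card = k) {u : ℝ}
    (h : ∀ l : Fin n, |((s ∩ Finset.univ.filter fun i => σ i < l).card : ℝ)
      - ((Finset.univ.filter fun i => σ i < l).card : ℝ) / 4| ≤ u) :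
    WellSampled k y s (2 * Real.pi / k * u) := by
  have hk0 : (0 : ℝ) < k := by exact_mod_cast hk
  -- The rank of `j` within the sample, counted from 0. Sending each sampled point to the grid point
  -- of its rank gives a regular tuple, and the angle error is `2 * π / k` times the deviation of
  -- one initial segment.
  set r : s → ℕ := fun j => (s ∩ Finset.univ.filter fun i => σ i < σ j).card with hr
  have hlt : ∀ j, r j < k := by
    intro j
    rw [← hs]
    refine Finset.card_lt_card ((Finset.ssubset_iff_of_subset Finset.inter_subset_left).2
      ⟨j, j.2, by simp⟩)
  have hmono : ∀ i j : s, σ i < σ j → r i < r j := by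
    intro i j hij
    refine Finset.card_lt_card ((Finset.ssubset_iff_of_subset ?_).2 ⟨i, ?_, ?_⟩)
    · intro l hl
      simp only [Finset.mem_inter, Finset.mem_filter, Finset.mem_univ, true_and] at hl ⊢
      exact ⟨hl.1, hl.2.trans hij⟩
    · simp [hij]
    · simp
  have hinj : Function.Injective fun j : s => (⟨r j, hlt j⟩ : Fin k) := by
    intro i j hij
    have hij' : r i = r j := congrArg Fin.val hij
    rcases lt_trichotomy (σ i) (σ j) with h' | h' | h'
    · exact absurd hij' (hmono i j h').ne
    · exact Subtype.ext (σ.injective h')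
    · exact absurd hij' (hmono j i h').ne'
  have hbij : Function.Bijective fun j : s => (⟨r j, hlt j⟩ : Fin k) :=
    (Fintype.bijective_iff_injective_and_card _).2 ⟨hinj, by simp [hs]⟩
  refine ⟨fun j => Circle.exp (2 * Real.pi * r j / k), ⟨Equiv.ofBijective _ hbij, fun j => rfl⟩,
    fun j => ?_⟩
  rw [hy]
  refine (geoDist_exp_le _ _).trans ?_
  have hc : (Finset.univ.filter fun i => σ i < σ j).card = (σ j : ℕ) := by
    have h1 : (Finset.univ.filter fun i => σ i < σ j) = (Finset.Iio (σ j)).map σ.symm.toEmbedding := by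
      ext i; simp
    rw [h1, Finset.card_map, Fin.card_Iio]
  have h2 := h (σ j)
  rw [hc] at h2
  have h3 : 2 * Real.pi * (σ j : ℕ) / n - 2 * Real.pi * r j / k
      = -(2 * Real.pi / k * (r j - ((σ j : ℕ) : ℝ) / 4)) := by
    rw [show (n : ℝ) = 4 * k by rw [hn]; push_cast; ring]
    field_simp
    ring
  rw [h3, abs_neg, abs_mul, abs_of_pos (by positivity : 0 < 2 * Real.pi / k)]
  gcongr

open Classical in
theorem card_not_wellSampled_le {n k : ℕ} (hk : 0 < k) (hn : n = 4 * k) {y : Fin n → Circle}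
    (hy : y ∈ regularTuples (Fin n) n) {t u : ℝ} (ht0 : 0 ≤ t) (ht : t ≤ 1) :
    (((Finset.powersetCard k (Finset.univ : Finset (Fin n))).filter
        fun S => ¬ WellSampled k y S (2 * Real.pi / k * u)).card : ℝ)
      ≤ n * (2 * (n + 1) * n.choose k * Real.exp (k * t ^ 2 - t * u)) := by
  obtain ⟨σ, hσ⟩ := hy
  have hsub : ((Finset.powersetCard k (Finset.univ : Finset (Fin n))).filter
        fun S => ¬ WellSampled k y S (2 * Real.pi / k * u)) ⊆
      (Finset.univ : Finset (Fin n)).biUnion fun l =>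
        (Finset.powersetCard k (Finset.univ : Finset (Fin n))).filter
          fun S => u < |((S ∩ Finset.univ.filter fun i => σ i < l).card : ℝ)
            - ((Finset.univ.filter fun i => σ i < l).card : ℝ) / 4| := by
    intro S hS
    rw [Finset.mem_filter] at hS
    by_contra hno
    simp only [Finset.mem_biUnion, Finset.mem_univ, true_and, Finset.mem_filter, not_exists,
      not_and, not_lt] at hno
    exact hS.2 (wellSampled_of_prefix hk hn σ hσ (Finset.mem_powersetCard.1 hS.1).2
      fun l => by
        have := hno l hS.1
        convert this)
  have h1 := (Finset.card_le_card hsub).trans Finset.card_biUnion_le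
  calc _ ≤ ∑ l : Fin n, (((Finset.powersetCard k (Finset.univ : Finset (Fin n))).filter
          fun S => u < |((S ∩ Finset.univ.filter fun i => σ i < l).card : ℝ)
            - ((Finset.univ.filter fun i => σ i < l).card : ℝ) / 4|).card : ℝ) := by
        exact_mod_cast h1
    _ ≤ ∑ l : Fin n, (2 * (n + 1) * n.choose k * Real.exp (k * t ^ 2 - t * u)) := by
        refine Finset.sum_le_sum fun l _ => ?_
        have h2 := card_filter_deviation_le (ι := Fin n) (k := k) (by rw [Fintype.card_fin, hn])
          (Finset.univ.filter fun i => σ i < l) (u := u) ht0 ht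
        rw [← hn, ← show (n : ℝ) = 4 * k by rw [hn]; push_cast; ring] at h2
        refine le_trans (le_of_eq ?_) h2
        congr!
    _ = _ := by rw [Finset.sum_const, Finset.card_univ, Fintype.card_fin, nsmul_eq_mul]

/-! ### The marginal distributions of the two samples -/

section Sampling

variable {n k : ℕ} {Ω : Type*} [MeasurableSpace Ω] {μ : Measure Ω} [IsFiniteMeasure μ]
  {A : Ω → Fin n → Fin n → ℝ} {S S' : Ω → Finset (Fin n)}

theorem measureReal_le_sum_pairs (hS : IsSampling k μ A S S')
    (B : Set (Finset (Fin n) × Finset (Fin n))) (P : Finset (Finset (Fin n) × Finset (Fin n)))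
    (hP : ∀ p, p ∈ P ↔ p ∈ B ∧ p.1.card = k ∧ p.2.card = k ∧ Disjoint p.1 p.2) :
    μ.real {ω | (S ω, S' ω) ∈ B}
      ≤ P.card * (1 / (n.choose k : ℝ) * (1 / ((n - k).choose k : ℝ))) := by
  have hsub : {ω | (S ω, S' ω) ∈ B} ⊆ ⋃ p ∈ P, {ω | S ω = p.1 ∧ S' ω = p.2} := by
    intro ω hω
    simp only [Set.mem_iUnion]
    exact ⟨(S ω, S' ω), (hP _).2 ⟨hω, hS.card_fst ω, hS.card_snd ω, hS.disjoint ω⟩, rfl, rfl⟩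
  calc _ ≤ μ.real (⋃ p ∈ P, {ω | S ω = p.1 ∧ S' ω = p.2}) := measureReal_mono hsub (measure_ne_top _ _)
    _ ≤ ∑ p ∈ P, μ.real {ω | S ω = p.1 ∧ S' ω = p.2} := measureReal_biUnion_finset_le _ _
    _ = ∑ p ∈ P, (1 / (n.choose k : ℝ) * (1 / ((n - k).choose k : ℝ))) := by
        refine Finset.sum_congr rfl fun p hp => ?_
        obtain ⟨-, h1, h2, h3⟩ := (hP p).1 hp
        exact hS.uniform _ _ h1 h2 h3
    _ = _ := by rw [Finset.sum_const, nsmul_eq_mul]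

open Classical in
-- Every admissible first set has `(n - k).choose k` partners, which cancels the second factor of
-- the uniform mass.
theorem measureReal_fst_mem_le (hS : IsSampling k μ A S S') (p : Finset (Fin n) → Prop) :
    μ.real {ω | p (S ω)} ≤ ((Finset.powersetCard k Finset.univ).filter p).card / n.choose k := by
  set P := ((Finset.powersetCard k (Finset.univ : Finset (Fin n))).filter p).biUnion fun s =>
    (Finset.powersetCard k sᶜ).map (Function.Embedding.sectR s (Finset (Fin n))) with hPdef
  have h1 := measureReal_le_sum_pairs hS {q | p q.1} P (by
    rintro ⟨s, s'⟩
    simp only [hPdef, Finset.mem_biUnion, Finset.mem_filter, Finset.mem_powersetCard,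
      Finset.subset_univ, true_and, Finset.mem_map, Function.Embedding.sectR_apply, Prod.mk.injEq,
      Set.mem_ofPred_eq]
    constructor
    · rintro ⟨s₀, ⟨h1, h2⟩, s₁, ⟨h3, h4⟩, rfl, rfl⟩
      exact ⟨h2, h1, h4, (Finset.subset_compl_iff_disjoint_left.1 h3)⟩
    · rintro ⟨h1, h2, h3, h4⟩
      exact ⟨s, ⟨h2, h1⟩, s', ⟨Finset.subset_compl_iff_disjoint_left.2 h4, h3⟩, rfl, rfl⟩)
  refine h1.trans ?_
  have h2 : P.card ≤ ((Finset.powersetCard k (Finset.univ : Finset (Fin n))).filter p).card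
      * (n - k).choose k := by
    refine Finset.card_biUnion_le_card_mul _ _ _ fun s hs => ?_
    rw [Finset.card_map, Finset.card_powersetCard, Finset.card_compl, Fintype.card_fin,
      (Finset.mem_powersetCard.1 (Finset.mem_filter.1 hs).1).2]
  have h3 : (P.card : ℝ) ≤ ((Finset.powersetCard k (Finset.univ : Finset (Fin n))).filter p).card
      * (n - k).choose k := by exact_mod_cast h2
  rcases Nat.eq_zero_or_pos ((n - k).choose k) with h0 | h0
  · rw [h0]; simp; positivity
  · have h4 : (0 : ℝ) < (n - k).choose k := by exact_mod_cast h0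
    calc _ ≤ ((Finset.powersetCard k (Finset.univ : Finset (Fin n))).filter p).card
      * (n - k).choose k * (1 / (n.choose k : ℝ) * (1 / ((n - k).choose k : ℝ))) := by gcongr
      _ = _ := by field_simp

end Sampling

/-- The pair is uniform on ordered disjoint pairs, so every estimate for `S` also holds for `S'`. -/
theorem IsSampling.swap {n k : ℕ} {Ω : Type*} [MeasurableSpace Ω] {μ : Measure Ω}
    {A : Ω → Fin n → Fin n → ℝ} {S S' : Ω → Finset (Fin n)} (hS : IsSampling k μ A S S') :
    IsSampling k μ A S' S where
  measurable_fst := hS.measurable_snd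
  measurable_snd := hS.measurable_fst
  card_fst := hS.card_snd
  card_snd := hS.card_fst
  disjoint ω := (hS.disjoint ω).symm
  uniform s s' hs hs' hss := by
    rw [← hS.uniform s' s hs' hs hss.symm]
    simp only [and_comm]
  indep := hS.indep.comp measurable_id measurable_swap

theorem measureReal_not_wellSampled_le {n k : ℕ} {Ω : Type*} [MeasurableSpace Ω] {μ : Measure Ω}
    [IsFiniteMeasure μ] {A : Ω → Fin n → Fin n → ℝ} {S S' : Ω → Finset (Fin n)}
    (hS : IsSampling k μ A S S') (hk : 0 < k) (hn : n = 4 * k) {y : Fin n → Circle}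
    (hy : y ∈ regularTuples (Fin n) n) {t u : ℝ} (ht0 : 0 ≤ t) (ht : t ≤ 1) :
    μ.real {ω | ¬ WellSampled k y (S ω) (2 * Real.pi / k * u)}
      ≤ n * (2 * (n + 1) * Real.exp (k * t ^ 2 - t * u)) := by
  have h0 : (0 : ℝ) < n.choose k := by exact_mod_cast Nat.choose_pos (by omega)
  refine (measureReal_fst_mem_le hS
    fun s => ¬ WellSampled k y s (2 * Real.pi / k * u)).trans ?_
  rw [div_le_iff₀ h0]
  refine le_trans (le_of_eq ?_)
    ((card_not_wellSampled_le hk hn hy (u := u) ht0 ht).trans (le_of_eq ?_))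
  · congr!
  · ring

/-! ### Deviations of linear forms in the noise -/

section Noise

variable {n : ℕ} {Ω : Type*} [MeasurableSpace Ω] {μ : Measure Ω}
  {A : Ω → Fin n → Fin n → ℝ}


theorem IsObservation.meanMatrix_symm (hA : IsObservation μ A) (i j : Fin n) :
    meanMatrix μ A i j = meanMatrix μ A j i := by
  unfold meanMatrix
  simp only [hA.symm _ i j]

theorem IsObservation.noise_symm (hA : IsObservation μ A) (i j : Fin n) (ω : Ω) :
    noise μ A i j ω = noise μ A j i ω := by
  unfold noise
  rw [hA.symm ω i j, hA.meanMatrix_symm i j]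

theorem IsObservation.noise_diag (hA : IsObservation μ A) (i : Fin n) (ω : Ω) :
    noise μ A i i ω = 0 := by
  simp [noise, meanMatrix, hA.diag]

theorem IsObservation.measurable_apply (hA : IsObservation μ A) (i j : Fin n) :
    Measurable fun ω => A ω i j :=
  (measurable_pi_apply j).comp ((measurable_pi_apply i).comp hA.measurable)

theorem IsObservation.measurable_noise (hA : IsObservation μ A) (i j : Fin n) :
    Measurable (noise μ A i j) := (hA.measurable_apply i j).sub_const _

theorem sum_sum_eq_sum_Ioi (G : Fin n → Fin n → ℝ) :
    ∑ i, ∑ j, G i j = ∑ i, ∑ j ∈ Finset.Ioi i, (G i j + G j i) + ∑ i, G i i := by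
  have h := Finset.sum_sum_Ioi_add_eq_sum_sum_off_diag fun i j => G j i
  rw [h, ← Finset.sum_add_distrib]
  refine Finset.sum_congr rfl fun i _ => ?_
  rw [← Finset.sum_add_sum_compl {i} (G i), Finset.sum_singleton, add_comm]

/-- The full double sum folds onto the entries above the diagonal with weights `W i j + W j i`; the
factor 2 is the price of `(a + b) ^ 2 ≤ 2 * (a ^ 2 + b ^ 2)`. -/
theorem IsObservation.tail_le [IsFiniteMeasure μ] (hA : IsObservation μ A)
    (W : Fin n → Fin n → ℝ) {t : ℝ} (ht : 0 ≤ t) :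
    μ.real {ω | t * Real.sqrt (2 * ∑ i, ∑ j, W i j ^ 2) < ∑ i, ∑ j, W i j * noise μ A i j ω}
      ≤ Real.exp (-t ^ 2 / 2) := by
  refine le_trans (measureReal_mono (fun ω hω => ?_) (measure_ne_top _ _))
    (hA.subGaussian (fun i j => W i j + W j i) t ht)
  have h1 : ∑ i, ∑ j, W i j * noise μ A i j ω
      = ∑ i, ∑ j ∈ Finset.Ioi i, (W i j + W j i) * noise μ A i j ω := by
    rw [sum_sum_eq_sum_Ioi]
    simp only [hA.noise_diag, mul_zero, Finset.sum_const_zero, add_zero]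
    refine Finset.sum_congr rfl fun i _ => Finset.sum_congr rfl fun j _ => ?_
    rw [hA.noise_symm j i]; ring
  have h2 : ∑ i, ∑ j ∈ Finset.Ioi i, (W i j + W j i) ^ 2 ≤ 2 * ∑ i, ∑ j, W i j ^ 2 := by
    have h3 := sum_sum_eq_sum_Ioi fun i j => W i j ^ 2
    have h4 : 0 ≤ ∑ i, W i i ^ 2 := Finset.sum_nonneg fun i _ => sq_nonneg _
    calc _ ≤ ∑ i, ∑ j ∈ Finset.Ioi i, 2 * (W i j ^ 2 + W j i ^ 2) :=
          Finset.sum_le_sum fun i _ => Finset.sum_le_sum fun j _ => by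
            nlinarith [sq_nonneg (W i j - W j i)]
      _ = 2 * ∑ i, ∑ j ∈ Finset.Ioi i, (W i j ^ 2 + W j i ^ 2) := by
          simp only [Finset.mul_sum]
      _ ≤ _ := by linarith
  have h5 : t * Real.sqrt (2 * ∑ i, ∑ j, W i j ^ 2) < ∑ i, ∑ j, W i j * noise μ A i j ω := hω
  show t * _ < _
  rw [← h1]
  exact lt_of_le_of_lt (by gcongr) h5

theorem sum_dite_mem_eq {s : Finset (Fin n)} (c : s → ℝ) :
    ∑ i, (if h : i ∈ s then c ⟨i, h⟩ else 0) = ∑ i, c i := by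
  rw [← Finset.sum_subset (Finset.subset_univ s) fun i _ hi => dif_neg hi, ← Finset.sum_coe_sort]
  exact Finset.sum_congr rfl fun i _ => dif_pos i.2

theorem IsObservation.tail_sub_le [IsFiniteMeasure μ] (hA : IsObservation μ A)
    (s : Finset (Fin n)) (c : s → s → ℝ) {t : ℝ} (ht : 0 ≤ t) :
    μ.real {ω | t * Real.sqrt (2 * ∑ i, ∑ j, c i j ^ 2)
        < ∑ i : s, ∑ j : s, noise μ A i j ω * c i j}
      ≤ Real.exp (-t ^ 2 / 2) := by
  have h := hA.tail_le (fun i j => if hi : i ∈ s then (if hj : j ∈ s then c ⟨i, hi⟩ ⟨j, hj⟩ else 0)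
    else 0) ht
  convert h using 5 with ω
  · congr 3
    rw [← sum_dite_mem_eq]
    refine Finset.sum_congr rfl fun i _ => ?_
    split_ifs with hi
    · rw [← sum_dite_mem_eq]
      refine Finset.sum_congr rfl fun j _ => ?_
      split_ifs <;> simp
    · simp
  · rw [← sum_dite_mem_eq]
    refine Finset.sum_congr rfl fun i _ => ?_
    split_ifs with hi
    · rw [← sum_dite_mem_eq]
      refine Finset.sum_congr rfl fun j _ => ?_
      split_ifs
      · ring
      · simp
    · simp

theorem IsObservation.tail_row_le [IsFiniteMeasure μ] (hA : IsObservation μ A)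
    (s : Finset (Fin n)) (i : Fin n) (c : s → ℝ) {t : ℝ} (ht : 0 ≤ t) :
    μ.real {ω | t * Real.sqrt (2 * ∑ j, c j ^ 2) < ∑ j : s, noise μ A i j ω * c j}
      ≤ Real.exp (-t ^ 2 / 2) := by
  have h := hA.tail_le (fun i' j => if i' = i then (if hj : j ∈ s then c ⟨j, hj⟩ else 0)
    else 0) ht
  convert h using 5 with ω
  · congr 3
    rw [Finset.sum_eq_single i (fun i' _ hi' => by simp [hi']) (by simp), ← sum_dite_mem_eq]
    refine Finset.sum_congr rfl fun j _ => ?_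
    split_ifs <;> simp_all
  · rw [Finset.sum_eq_single i (fun i' _ hi' => by simp [hi']) (by simp), ← sum_dite_mem_eq]
    refine Finset.sum_congr rfl fun j _ => ?_
    split_ifs <;> simp_all [mul_comm]

/-- The regular tuple that visits the grid in the order given by `σ`. -/
noncomputable def gridTuple {ι : Type*} {k : ℕ} (σ : ι ≃ Fin k) (j : ι) : Circle :=
  Circle.exp (2 * Real.pi * (σ j : ℕ) / k)

theorem IsObservation.measureReal_not_initialNoiseBound_le_of_card [IsFiniteMeasure μ]
    (hA : IsObservation μ A) {k : ℕ} {t τ : ℝ} (ht : 0 ≤ t) (hτ : t * Real.sqrt 2 ≤ τ * k)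
    {s : Finset (Fin n)} (hs : s.card = k) :
    μ.real {ω | ¬ InitialNoiseBound k (fun i j => A ω i j - meanMatrix μ A i j) s τ}
      ≤ (k.factorial : ℝ) ^ 2 * Real.exp (-t ^ 2 / 2) := by
  let Δ : (s ≃ Fin k) × (s ≃ Fin k) → s → s → ℝ := fun p i j =>
    geoDist (gridTuple p.1 i) (gridTuple p.1 j) - geoDist (gridTuple p.2 i) (gridTuple p.2 j)
  have hsub : {ω | ¬ InitialNoiseBound k (fun i j => A ω i j - meanMatrix μ A i j) s τ}
      ⊆ ⋃ p ∈ (Finset.univ : Finset ((s ≃ Fin k) × (s ≃ Fin k))),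
        {ω | t * Real.sqrt (2 * ∑ i, ∑ j, Δ p i j ^ 2)
          < ∑ i : s, ∑ j : s, noise μ A i j ω * Δ p i j} := by
    intro ω hno
    replace hno : ¬ InitialNoiseBound k (fun i j => A ω i j - meanMatrix μ A i j) s τ := hno
    unfold InitialNoiseBound at hno
    push Not at hno
    obtain ⟨w, ⟨σ, hw⟩, y, ⟨σ', hy⟩, hlt⟩ := hno
    obtain rfl : w = gridTuple σ := funext hw
    obtain rfl : y = gridTuple σ' := funext hy
    simp only [Set.mem_iUnion]
    refine ⟨(σ', σ), Finset.mem_univ _, lt_of_le_of_lt ?_ hlt⟩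
    rw [Real.sqrt_mul (by norm_num), ← mul_assoc]
    gcongr
  refine (measureReal_mono hsub (measure_ne_top _ _)).trans ?_
  refine (measureReal_biUnion_finset_le _ _).trans ?_
  refine (Finset.sum_le_sum fun p _ => hA.tail_sub_le s (Δ p) ht).trans (le_of_eq ?_)
  have e : s ≃ Fin k := Fintype.equivFinOfCardEq (by simp [hs])
  rw [Finset.sum_const, Finset.card_univ, Fintype.card_prod, Fintype.card_equiv e,
    Fintype.card_coe, hs, nsmul_eq_mul]
  push_cast
  ring

/-- The initial noise bound holds simultaneously for all index sets. -/
theorem IsObservation.measureReal_not_initialNoiseBound_le [IsFiniteMeasure μ]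
    (hA : IsObservation μ A) {k : ℕ} {t τ : ℝ} (ht : 0 ≤ t) (hτ : t * Real.sqrt 2 ≤ τ * k) :
    μ.real {ω | ∃ s : Finset (Fin n), s.card = k ∧
        ¬ InitialNoiseBound k (fun i j => A ω i j - meanMatrix μ A i j) s τ}
      ≤ 2 ^ n * ((k.factorial : ℝ) ^ 2 * Real.exp (-t ^ 2 / 2)) := by
  set 𝒮 := (Finset.univ : Finset (Finset (Fin n))).filter fun s => s.card = k with h𝒮
  have hsub : {ω | ∃ s : Finset (Fin n), s.card = k ∧
        ¬ InitialNoiseBound k (fun i j => A ω i j - meanMatrix μ A i j) s τ}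
      ⊆ ⋃ s ∈ 𝒮, {ω | ¬ InitialNoiseBound k (fun i j => A ω i j - meanMatrix μ A i j) s τ} := by
    rintro ω ⟨s, hs, hno⟩
    simp only [Set.mem_iUnion]
    exact ⟨s, by simp [h𝒮, hs], hno⟩
  refine (measureReal_mono hsub (measure_ne_top _ _)).trans ?_
  refine (measureReal_biUnion_finset_le _ _).trans ?_
  refine (Finset.sum_le_sum fun s hs =>
    hA.measureReal_not_initialNoiseBound_le_of_card ht hτ (by simpa [h𝒮] using hs)).trans ?_
  rw [Finset.sum_const, nsmul_eq_mul]
  have h1 : 𝒮.card ≤ 2 ^ n := by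
    refine (Finset.card_le_univ _).trans (le_of_eq ?_)
    rw [Fintype.card_finset, Fintype.card_fin]
  gcongr
  exact_mod_cast h1

/-- The entries of the noise inside `s` are independent of the rows outside `s`. -/
theorem IsObservation.measureReal_loc_inter_le [IsFiniteMeasure μ] (hA : IsObservation μ A) {k : ℕ}
    {loc : (T : Finset (Fin n)) → (T → T → ℝ) → T → Circle} (hloc : IsInitialRule k loc)
    {s : Finset (Fin n)} (hs : s.card = k) (w : s → Circle) {i : Fin n} (hi : i ∉ s) (c : s → ℝ)
    {t : ℝ} (ht : 0 ≤ t) :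
    μ.real ({ω | loc s (sub (A ω) s) = w} ∩
        {ω | t * Real.sqrt (2 * ∑ j, c j ^ 2) < ∑ j : s, noise μ A i j ω * c j})
      ≤ μ.real {ω | loc s (sub (A ω) s) = w} * Real.exp (-t ^ 2 / 2) := by
  set m : {p : Fin n × Fin n // p.1 < p.2} → MeasurableSpace Ω := fun p =>
    MeasurableSpace.comap (noise μ A p.1.1 p.1.2) inferInstance with hm
  set P₁ : Set {p : Fin n × Fin n // p.1 < p.2} := {p | p.1.1 ∈ s ∧ p.1.2 ∈ s} with hP₁
  have hind : Indep (⨆ p ∈ P₁, m p) (⨆ p ∈ P₁ᶜ, m p) μ :=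
    indep_iSup_of_disjoint (fun p => (hA.measurable_noise _ _).comap_le) hA.indep.iIndep
      disjoint_compl_right
  -- Independence is stated only above the diagonal; symmetry and the zero diagonal extend
  -- measurability to any entry.
  have hmeas : ∀ (P : Set {p : Fin n × Fin n // p.1 < p.2}) (a b : Fin n),
      (∀ h : a < b, ⟨(a, b), h⟩ ∈ P) → (∀ h : b < a, ⟨(b, a), h⟩ ∈ P) →
      Measurable[⨆ p ∈ P, m p] (noise μ A a b) := by
    intro P a b hab hba
    rcases lt_trichotomy a b with h | rfl | h
    · exact (comap_measurable (noise μ A a b)).mono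
        (le_iSup₂_of_le (f := fun p _ => m p) ⟨(a, b), h⟩ (hab h) le_rfl) le_rfl
    · have h0 : noise μ A a a = fun _ => 0 := funext fun ω => hA.noise_diag a ω
      rw [h0]
      exact measurable_const
    · have h0 : noise μ A a b = noise μ A b a := funext fun ω => hA.noise_symm a b ω
      rw [h0]
      exact (comap_measurable (noise μ A b a)).mono
        (le_iSup₂_of_le (f := fun p _ => m p) ⟨(b, a), h⟩ (hba h) le_rfl) le_rfl
  have h1 : MeasurableSet[⨆ p ∈ P₁, m p] {ω | loc s (sub (A ω) s) = w} := by
    have h2 : Measurable[⨆ p ∈ P₁, m p] fun ω => sub (A ω) s := by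
      refine @measurable_pi_lambda _ _ _ (_) _ _ fun a => @measurable_pi_lambda _ _ _ (_) _ _ fun b => ?_
      have h3 : (fun ω => sub (A ω) s a b) = fun ω => noise μ A a b ω + meanMatrix μ A a b := by
        funext ω
        simp [sub, noise]
      rw [h3]
      exact (hmeas P₁ a b (fun _ => ⟨a.2, b.2⟩) (fun _ => ⟨b.2, a.2⟩)).add_const _
    exact h2 (hloc.measurable s hs w)
  have h2 : MeasurableSet[⨆ p ∈ P₁ᶜ, m p]
      {ω | t * Real.sqrt (2 * ∑ j, c j ^ 2) < ∑ j : s, noise μ A i j ω * c j} := by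
    have h3 : Measurable[⨆ p ∈ P₁ᶜ, m p] fun ω => ∑ j : s, noise μ A i j ω * c j := by
      refine Finset.measurable_fun_sum _ fun j _ => ?_
      exact (hmeas P₁ᶜ i j (fun _ h => hi h.1) (fun _ h => hi h.2)).mul_const _
    exact h3 measurableSet_Ioi
  have h3 := (Indep_iff _ _ _).1 hind _ _ h1 h2
  rw [measureReal_def, h3, ENNReal.toReal_mul]
  exact mul_le_mul_of_nonneg_left (hA.tail_row_le s i c ht) ENNReal.toReal_nonneg

theorem finite_regularTuples (ι : Type*) [Fintype ι] (k : ℕ) : (regularTuples ι k).Finite := by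
  classical
  refine (Set.finite_range fun (σ : ι ≃ Fin k) (j : ι) =>
    Circle.exp (2 * Real.pi * (σ j : ℕ) / k)).subset ?_
  rintro y ⟨σ, hσ⟩
  exact ⟨σ, (funext hσ).symm⟩

/-- A union bound over all initial localizations would cost `k!`. Instead, the event is split by the
values of the sample and of the initial localization. Given these, the outside rows keep their tail
bound, so only `n * k ^ 2` choices are paid for and the weights sum to at most 1. -/
theorem measureReal_not_refineNoiseBound_le [IsProbabilityMeasure μ] (hA : IsObservation μ A)
    {k : ℕ} {S S' : Ω → Finset (Fin n)} (hS : IsSampling k μ A S S')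
    {loc : (T : Finset (Fin n)) → (T → T → ℝ) → T → Circle} (hloc : IsInitialRule k loc)
    {t τ : ℝ} (ht : 0 ≤ t) (hτ : t * Real.sqrt 2 ≤ τ * Real.sqrt k) :
    μ.real {ω | ¬ RefineNoiseBound k (fun i j => A ω i j - meanMatrix μ A i j) (S ω)
        (loc (S ω) (sub (A ω) (S ω))) τ} ≤ n * k ^ 2 * Real.exp (-t ^ 2 / 2) := by
  classical
  set gp : Fin k → Circle := fun l => Circle.exp (2 * Real.pi * (l : ℕ) / k) with hgp
  set cf : (s : Finset (Fin n)) → (s → Circle) → Fin k × Fin k → s → ℝ :=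
    fun s w p j => geoDist (gp p.1) (w j) - geoDist (gp p.2) (w j) with hcf
  set V : (s : Finset (Fin n)) → (s → Circle) → Fin n × (Fin k × Fin k) → Set Ω := fun s w q =>
    {ω | t * Real.sqrt (2 * ∑ j, cf s w q.2 j ^ 2) < ∑ j : s, noise μ A q.1 j ω * cf s w q.2 j} with hV
  set 𝒮 := (Finset.univ : Finset (Finset (Fin n))).filter fun s => s.card = k with h𝒮
  set 𝒲 : (s : Finset (Fin n)) → Finset (s → Circle) := fun s =>
    (finite_regularTuples s k).toFinset with h𝒲
  set 𝒬 : Finset (Fin n) → Finset (Fin n × (Fin k × Fin k)) := fun s => sᶜ ×ˢ Finset.univ with h𝒬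
  set L : (s : Finset (Fin n)) → (s → Circle) → Set Ω := fun s w =>
    {ω | loc s (sub (A ω) s) = w} with hL
  have hsub : {ω | ¬ RefineNoiseBound k (fun i j => A ω i j - meanMatrix μ A i j) (S ω)
        (loc (S ω) (sub (A ω) (S ω))) τ}
      ⊆ ⋃ s ∈ 𝒮, ⋃ w ∈ 𝒲 s, ⋃ q ∈ 𝒬 s, (S ⁻¹' {s} ∩ (L s w ∩ V s w q)) := by
    intro ω hω
    have hno : ¬ RefineNoiseBound k (fun i j => A ω i j - meanMatrix μ A i j) (S ω)
        (loc (S ω) (sub (A ω) (S ω))) τ := hω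
    have hcard := hS.card_fst ω
    generalize hs : S ω = s at hno hcard
    generalize hw : loc s (sub (A ω) s) = w at hno
    unfold RefineNoiseBound at hno
    push Not at hno
    obtain ⟨i, hi, z, ⟨l, rfl⟩, z', ⟨l', rfl⟩, hlt⟩ := hno
    simp only [Set.mem_iUnion]
    refine ⟨s, by simp [h𝒮, hcard], w, by
      simp only [h𝒲, Set.Finite.mem_toFinset, ← hw]; exact hloc.mem s hcard _, (i, (l', l)),
      by simp [h𝒬, hi], hs, hw, lt_of_le_of_lt ?_ hlt⟩
    rw [Real.sqrt_mul (by norm_num), ← mul_assoc]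
    gcongr
  set e := Real.exp (-t ^ 2 / 2) with he
  have he0 : 0 ≤ e := (Real.exp_pos _).le
  have hpiece : ∀ s ∈ 𝒮, ∀ w ∈ 𝒲 s, ∀ q ∈ 𝒬 s, μ.real (S ⁻¹' {s} ∩ (L s w ∩ V s w q))
      ≤ μ.real (S ⁻¹' {s}) * (μ.real (L s w) * e) := by
    intro s hs w _ q hq
    have hs' : s.card = k := by simpa [h𝒮] using hs
    have hq' : q.1 ∉ s := by simpa [h𝒬] using hq
    set N : Set (Fin n → Fin n → ℝ) := {M | loc s (sub M s) = w} ∩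
      {M | t * Real.sqrt (2 * ∑ j, cf s w q.2 j ^ 2)
        < ∑ j : s, (M q.1 j - meanMatrix μ A q.1 j) * cf s w q.2 j} with hN
    have hNm : MeasurableSet N := by
      refine MeasurableSet.inter ?_ ?_
      · have h1 : Measurable fun M : Fin n → Fin n → ℝ => sub M s :=
          measurable_pi_lambda _ fun a => measurable_pi_lambda _ fun b =>
            (measurable_pi_apply (b : Fin n)).comp (measurable_pi_apply (a : Fin n))
        exact h1 (hloc.measurable s hs' w)
      · have h1 : Measurable fun M : Fin n → Fin n → ℝ =>
            ∑ j : s, (M q.1 j - meanMatrix μ A q.1 j) * cf s w q.2 j := by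
          refine Finset.measurable_fun_sum _ fun j _ => ?_
          exact (((measurable_pi_apply (j : Fin n)).comp
            (measurable_pi_apply q.1)).sub_const _).mul_const _
        exact h1 measurableSet_Ioi
    -- Independence of the sample from `A` fixes `S = s`; independence within `A` then separates the
    -- localization from the row.
    have h1 := hS.indep.measure_inter_preimage_eq_mul N (Prod.fst ⁻¹' {s}) hNm
      (measurable_fst (measurableSet_singleton s))
    have h2 : S ⁻¹' {s} ∩ (L s w ∩ V s w q)
        = A ⁻¹' N ∩ (fun ω => (S ω, S' ω)) ⁻¹' (Prod.fst ⁻¹' {s}) := by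
      rw [Set.inter_comm]; rfl
    have h3 : (fun ω => (S ω, S' ω)) ⁻¹' (Prod.fst ⁻¹' {s}) = S ⁻¹' {s} := rfl
    rw [h2, measureReal_def, h1, ENNReal.toReal_mul, mul_comm, h3]
    exact mul_le_mul_of_nonneg_left (hA.measureReal_loc_inter_le hloc hs' w hq' _ ht)
      ENNReal.toReal_nonneg
  have hsumS : ∑ s ∈ 𝒮, μ.real (S ⁻¹' {s}) ≤ 1 := by
    rw [sum_measureReal_preimage_singleton 𝒮
      (fun s _ => hS.measurable_fst (measurableSet_singleton s)) (fun _ _ => measure_ne_top _ _)]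
    exact measureReal_le_one
  have hsumW : ∀ s ∈ 𝒮, ∑ w ∈ 𝒲 s, μ.real (L s w) ≤ 1 := by
    intro s hs
    have hs' : s.card = k := by simpa [h𝒮] using hs
    have h1 : Measurable fun ω => sub (A ω) s :=
      measurable_pi_lambda _ fun a => measurable_pi_lambda _ fun b => hA.measurable_apply _ _
    have h2 := sum_measureReal_preimage_singleton (μ := μ) (𝒲 s)
      (f := fun ω => loc s (sub (A ω) s)) (fun w _ => h1 (hloc.measurable s hs' w))
      (fun _ _ => measure_ne_top _ _)
    exact h2.le.trans measureReal_le_one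
  calc _ ≤ μ.real (⋃ s ∈ 𝒮, ⋃ w ∈ 𝒲 s, ⋃ q ∈ 𝒬 s, (S ⁻¹' {s} ∩ (L s w ∩ V s w q))) :=
        measureReal_mono hsub (measure_ne_top _ _)
    _ ≤ ∑ s ∈ 𝒮, ∑ w ∈ 𝒲 s, ∑ q ∈ 𝒬 s, μ.real (S ⁻¹' {s} ∩ (L s w ∩ V s w q)) := by
        refine (measureReal_biUnion_finset_le _ _).trans (Finset.sum_le_sum fun s _ => ?_)
        refine (measureReal_biUnion_finset_le _ _).trans (Finset.sum_le_sum fun w _ => ?_)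
        exact measureReal_biUnion_finset_le _ _
    _ ≤ ∑ s ∈ 𝒮, ∑ w ∈ 𝒲 s, ∑ q ∈ 𝒬 s, μ.real (S ⁻¹' {s}) * (μ.real (L s w) * e) :=
        Finset.sum_le_sum fun s hs => Finset.sum_le_sum fun w hw => Finset.sum_le_sum fun q hq =>
          hpiece s hs w hw q hq
    _ ≤ ∑ s ∈ 𝒮, ∑ w ∈ 𝒲 s, (n * k ^ 2) * (μ.real (S ⁻¹' {s}) * (μ.real (L s w) * e)) := by
        refine Finset.sum_le_sum fun s _ => Finset.sum_le_sum fun w _ => ?_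
        rw [Finset.sum_const, nsmul_eq_mul]
        refine mul_le_mul_of_nonneg_right ?_
          (mul_nonneg measureReal_nonneg (mul_nonneg measureReal_nonneg he0))
        have h1 : (𝒬 s).card ≤ n * k ^ 2 := by
          simp only [h𝒬, Finset.card_product, Finset.card_univ, Fintype.card_prod, Fintype.card_fin,
            sq]
          gcongr
          exact (Finset.card_le_univ _).trans (by rw [Fintype.card_fin])
        exact_mod_cast h1
    _ = (n * k ^ 2 * e) * ∑ s ∈ 𝒮, μ.real (S ⁻¹' {s}) * ∑ w ∈ 𝒲 s, μ.real (L s w) := by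
        rw [Finset.mul_sum]
        refine Finset.sum_congr rfl fun s _ => ?_
        rw [Finset.mul_sum, Finset.mul_sum]
        refine Finset.sum_congr rfl fun w _ => ?_
        ring
    _ ≤ (n * k ^ 2 * e) * 1 := by
        refine mul_le_mul_of_nonneg_left ?_ (by positivity)
        refine le_trans (Finset.sum_le_sum fun s hs => ?_) hsumS
        exact mul_le_of_le_one_right measureReal_nonneg (hsumW s hs)
    _ = _ := mul_one _

end Noise

/-! ### Approximation by regular tuples -/

theorem distRegular_nonneg {n : ℕ} (x : Fin n → Circle) : 0 ≤ distRegular x :=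
  Real.iInf_nonneg fun _ => Real.iSup_nonneg fun _ => geoDist_nonneg _ _

theorem geoDist_le_dInf {ι : Type*} [Finite ι] (x y : ι → Circle) (i : ι) :
    geoDist (x i) (y i) ≤ dInf x y :=
  le_ciSup (f := fun i => geoDist (x i) (y i)) (Set.finite_range _).bddAbove i

theorem exists_regular_geoDist_le {n : ℕ} (x : Fin n → Circle) {r : ℝ} (hr : 0 < r) :
    ∃ y ∈ regularTuples (Fin n) n, ∀ i, geoDist (x i) (y i) ≤ distRegular x + r := by
  have : Nonempty (regularTuples (Fin n) n) :=
    ⟨⟨fun j => Circle.exp (2 * Real.pi * (j : ℕ) / n), Equiv.refl _, fun _ => rfl⟩⟩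
  obtain ⟨y, hy⟩ := exists_lt_of_ciInf_lt
    (show ⨅ y : regularTuples (Fin n) n, dInf x (y : Fin n → Circle) < distRegular x + r from
      lt_add_of_pos_right _ hr)
  exact ⟨y, y.2, fun i => (geoDist_le_dInf x y i).trans hy.le⟩

theorem WellSampled.of_close {n k : ℕ} {x y : Fin n → Circle} {s : Finset (Fin n)} {r u : ℝ}
    (h : WellSampled k y s u) (hxy : ∀ i, geoDist (x i) (y i) ≤ r) : WellSampled k x s (r + u) := by
  obtain ⟨v, hv, hyv⟩ := h
  exact ⟨v, hv, fun j => (geoDist_triangle _ (y j) _).trans (add_le_add (hxy j) (hyv j))⟩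

/-! ### The rate -/

/-- The statistical rate `√(log n / n)`. -/
noncomputable def rate (n : ℕ) : ℝ := Real.sqrt (Real.log n / n)

section Rate

variable {n : ℕ}

theorem one_le_log (hn : 4 ≤ n) : 1 ≤ Real.log n := by
  have hn' : (4 : ℝ) ≤ n := by exact_mod_cast hn
  rw [Real.le_log_iff_exp_le (by linarith)]
  linarith [Real.exp_one_lt_d9]

theorem rate_sq (hn : 4 ≤ n) : rate n ^ 2 * n = Real.log n := by
  have hn' : (0 : ℝ) < n := by exact_mod_cast (by omega : 0 < n)
  have := one_le_log hn
  rw [rate, Real.sq_sqrt (by positivity), div_mul_cancel₀ _ hn'.ne']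

theorem inv_le_rate (hn : 4 ≤ n) : 1 / (n : ℝ) ≤ rate n := by
  have hn' : (4 : ℝ) ≤ n := by exact_mod_cast hn
  refine Real.le_sqrt_of_sq_le ?_
  rw [div_pow, one_pow, div_le_div_iff₀ (by positivity) (by positivity)]
  nlinarith [mul_le_mul_of_nonneg_right (one_le_log hn) (sq_nonneg (n : ℝ))]

theorem rate_pos (hn : 4 ≤ n) : 0 < rate n := by
  have hn' : (0 : ℝ) < n := by exact_mod_cast (by omega : 0 < n)
  exact lt_of_lt_of_le (by positivity) (inv_le_rate hn)

theorem rate_le_one (hn : 4 ≤ n) : rate n ≤ 1 := by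
  have hn' : (0 : ℝ) < n := by exact_mod_cast (by omega : 0 < n)
  rw [rate, Real.sqrt_le_one, div_le_one hn']
  linarith [Real.log_le_sub_one_of_pos hn']

theorem rate_ge_of_lt (hn : 4 ≤ n) (hn' : n ≤ 36) : 1 / 6 ≤ rate n := by
  have h1 : (n : ℝ) ≤ 36 := by exact_mod_cast hn'
  have h2 : (0 : ℝ) < n := by exact_mod_cast (by omega : 0 < n)
  refine Real.le_sqrt_of_sq_le ?_
  rw [le_div_iff₀ h2]
  linarith [one_le_log hn]

theorem exp_neg_three_log (hn : 0 < n) : Real.exp (-3 * Real.log n) = 1 / (n : ℝ) ^ 3 := by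
  have h2 : (0 : ℝ) < n := by exact_mod_cast hn
  rw [show -3 * Real.log n = -((3 : ℕ) * Real.log n) by push_cast; ring, Real.exp_neg,
    Real.exp_nat_mul, Real.exp_log h2, one_div]

theorem pow_eq_exp_log (hn : 0 < n) (m : ℕ) : (n : ℝ) ^ m = Real.exp (m * Real.log n) := by
  have h2 : (0 : ℝ) < n := by exact_mod_cast hn
  rw [Real.exp_nat_mul, Real.exp_log h2]

end Rate

/-! ### Probabilities of the unfavourable events -/

section Events

variable {n k : ℕ} {Ω : Type*} [MeasurableSpace Ω] {μ : Measure Ω}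
  {A : Ω → Fin n → Fin n → ℝ} {S S' : Ω → Finset (Fin n)}

theorem prob_not_wellSampled_le [IsFiniteMeasure μ] (hS : IsSampling k μ A S S') (hk : 0 < k)
    (hn : n = 4 * k) {y : Fin n → Circle} (hy : y ∈ regularTuples (Fin n) n) :
    μ.real {ω | ¬ WellSampled k y (S ω) (182 * rate n)} ≤ 1 / (n : ℝ) ^ 3 := by
  have hn4 : 4 ≤ n := by omega
  have hn0 : 0 < n := by omega
  have hnk : (n : ℝ) = 4 * k := by rw [hn]; push_cast; ring
  have hk0 : (0 : ℝ) < k := by exact_mod_cast hk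
  have hr := rate_pos hn4
  have hl := one_le_log hn4
  have hr2 := rate_sq hn4
  -- The exponent is `(1 / 4 - 7) * log n ≤ -6 * log n`, against a prefactor at most `n ^ 3`. The
  -- resulting radius `56 * π * rate n` explains 182.
  have h1 := measureReal_not_wellSampled_le hS hk hn hy (t := rate n) (u := 7 * n * rate n)
    hr.le (rate_le_one hn4)
  have h2 : 2 * Real.pi / k * (7 * n * rate n) ≤ 182 * rate n := by
    have h3 : 2 * Real.pi / k * (7 * n * rate n) = 56 * Real.pi * rate n := by
      rw [hnk]; field_simp; ring
    rw [h3]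
    gcongr
    linarith [Real.pi_lt_d2]
  refine (measureReal_mono ?_ (measure_ne_top _ _)).trans (h1.trans ?_)
  · rintro ω hω ⟨v, hv, hyv⟩
    exact hω ⟨v, hv, fun j => (hyv j).trans h2⟩
  · have hn4' : (4 : ℝ) ≤ n := by exact_mod_cast hn4
    have h4 : (n : ℝ) * (2 * (n + 1)) ≤ n ^ 3 := by
      have h6 : 2 * ((n : ℝ) + 1) ≤ n ^ 2 := by nlinarith
      calc (n : ℝ) * (2 * (n + 1)) ≤ n * n ^ 2 := by gcongr
        _ = n ^ 3 := by ring
    have h5 : k * rate n ^ 2 - rate n * (7 * n * rate n) ≤ -6 * Real.log n := by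
      rw [← hr2, hnk]; nlinarith [mul_pos hk0 (pow_pos hr 2)]
    calc _ = (n : ℝ) * (2 * (n + 1)) * Real.exp (k * rate n ^ 2 - rate n * (7 * n * rate n)) := by
          ring
      _ ≤ n ^ 3 * Real.exp (-6 * Real.log n) := by gcongr
      _ = 1 / (n : ℝ) ^ 3 := by
          rw [← exp_neg_three_log hn0, pow_eq_exp_log hn0, ← Real.exp_add]
          congr 1; push_cast; ring

theorem prob_not_initialNoiseBound_le [IsFiniteMeasure μ] (hA : IsObservation μ A) (hk : 0 < k)
    (hn : n = 4 * k) {τ : ℝ} (hτ : 32 * rate n ≤ τ) :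
    μ.real {ω | ∃ s : Finset (Fin n), s.card = k ∧
        ¬ InitialNoiseBound k (fun i j => A ω i j - meanMatrix μ A i j) s τ} ≤ 1 / (n : ℝ) ^ 3 := by
  have hn4 : 4 ≤ n := by omega
  have hn0 : 0 < n := by omega
  have hnk : (n : ℝ) = 4 * k := by rw [hn]; push_cast; ring
  have hk1 : (1 : ℝ) ≤ k := by exact_mod_cast hk
  have hr := rate_pos hn4
  have hl := one_le_log hn4
  have hr2 := rate_sq hn4
  have hsqrt : Real.sqrt 2 ≤ 2 := Real.sqrt_le_iff.2 ⟨by norm_num, by norm_num⟩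
  -- `t ^ 2 / 2 = 8 * n * log n` beats the `2 ^ n * k! ^ 2 ≤ n ^ (n + 2 * k)` events of the union
  -- bound.
  refine (hA.measureReal_not_initialNoiseBound_le (t := 4 * n * rate n) (by positivity) ?_).trans ?_
  · calc 4 * n * rate n * Real.sqrt 2 ≤ 4 * n * rate n * 2 := by gcongr
      _ = 32 * rate n * k := by rw [hnk]; ring
      _ ≤ τ * k := by gcongr
  · have h1 : (k.factorial : ℝ) ≤ (n : ℝ) ^ k := by
      calc (k.factorial : ℝ) ≤ (k : ℝ) ^ k := by exact_mod_cast Nat.factorial_le_pow k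
        _ ≤ (n : ℝ) ^ k := by gcongr; omega
    have h2 : (2 : ℝ) ^ n ≤ (n : ℝ) ^ n := by
      gcongr
      exact_mod_cast (by omega : 2 ≤ n)
    have h3 : -(4 * n * rate n) ^ 2 / 2 = -8 * n * Real.log n := by rw [← hr2]; ring
    rw [h3]
    calc _ ≤ (n : ℝ) ^ n * (((n : ℝ) ^ k) ^ 2 * Real.exp (-8 * n * Real.log n)) := by gcongr
      _ = Real.exp ((-8 * n + n + 2 * k) * Real.log n) := by
          rw [← pow_mul, pow_eq_exp_log hn0, pow_eq_exp_log hn0, ← Real.exp_add, ← Real.exp_add]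
          congr 1; push_cast; ring
      _ ≤ Real.exp (-3 * Real.log n) := by
          refine Real.exp_le_exp.2 (mul_le_mul_of_nonneg_right ?_ (by linarith))
          rw [hnk]; linarith
      _ = _ := exp_neg_three_log hn0

theorem prob_not_refineNoiseBound_le [IsProbabilityMeasure μ] (hA : IsObservation μ A)
    (hS : IsSampling k μ A S S') (hk : 0 < k) (hn : n = 4 * k)
    {loc : (T : Finset (Fin n)) → (T → T → ℝ) → T → Circle} (hloc : IsInitialRule k loc)
    {τ : ℝ} (hτ : 16 * rate n ≤ τ) :
    μ.real {ω | ¬ RefineNoiseBound k (fun i j => A ω i j - meanMatrix μ A i j) (S ω)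
        (loc (S ω) (sub (A ω) (S ω))) τ} ≤ 1 / (n : ℝ) ^ 3 := by
  have hn4 : 4 ≤ n := by omega
  have hn0 : 0 < n := by omega
  have hnk : (n : ℝ) = 4 * k := by rw [hn]; push_cast; ring
  have hr := rate_pos hn4
  have hl := one_le_log hn4
  have hr2 := rate_sq hn4
  have hk0 : (0 : ℝ) ≤ k := Nat.cast_nonneg k
  have hsqrt : Real.sqrt 2 ≤ 2 := Real.sqrt_le_iff.2 ⟨by norm_num, by norm_num⟩
  -- `t ^ 2 / 2 = 8 * log n`, against `n * k ^ 2 ≤ n ^ 3` events.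
  refine (measureReal_not_refineNoiseBound_le hA hS hloc (t := 8 * rate n * Real.sqrt k)
    (by positivity) ?_).trans ?_
  · calc 8 * rate n * Real.sqrt k * Real.sqrt 2 ≤ 8 * rate n * Real.sqrt k * 2 := by gcongr
      _ = 16 * rate n * Real.sqrt k := by ring
      _ ≤ τ * Real.sqrt k := by gcongr
  · have h3 : -(8 * rate n * Real.sqrt k) ^ 2 / 2 = -8 * Real.log n := by
      rw [mul_pow, Real.sq_sqrt hk0, ← hr2, hnk]; ring
    rw [h3]
    calc _ ≤ (n : ℝ) * (n : ℝ) ^ 2 * Real.exp (-8 * Real.log n) := by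
          gcongr
          omega
      _ = Real.exp (-5 * Real.log n) := by
          rw [← pow_succ', pow_eq_exp_log hn0, ← Real.exp_add]
          congr 1; push_cast; ring
      _ ≤ Real.exp (-3 * Real.log n) := by
          refine Real.exp_le_exp.2 (mul_le_mul_of_nonneg_right ?_ (by linarith))
          norm_num
      _ = _ := exp_neg_three_log hn0

end Events

/-! ### Uniformity over the representations and conclusion -/

/-- The favourable event must be fixed before the representation to be estimated, so it is built on
a deterministic reference. A near minimizer avoids asking whether the infimum is attained; `r` is
absorbed by the rate. -/
theorem exists_near_minimal_representation {n : ℕ} {F : Fin n → Fin n → ℝ} {cl cL ce : ℝ}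
    {xstar : Fin n → Circle} {fstar : Circle → Circle → ℝ}
    (h : IsRepresentation F cl cL ce xstar fstar) {r : ℝ} (hr : 0 < r) :
    ∃ x₀ f₀, IsRepresentation F cl cL ce x₀ f₀ ∧
      ∀ x f, IsRepresentation F cl cL ce x f → distRegular x₀ ≤ distRegular x + r := by
  set D : Set ℝ := {d | ∃ x f, IsRepresentation F cl cL ce x f ∧ distRegular x = d} with hD
  have hne : D.Nonempty := ⟨_, xstar, fstar, h, rfl⟩
  have hbdd : BddBelow D := ⟨0, by rintro _ ⟨x, f, -, rfl⟩; exact distRegular_nonneg x⟩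
  obtain ⟨_, ⟨x₀, f₀, hx₀, rfl⟩, hlt⟩ := exists_lt_of_csInf_lt hne (lt_add_of_pos_right (sInf D) hr)
  refine ⟨x₀, f₀, hx₀, fun x f hx => hlt.le.trans ?_⟩
  have := csInf_le hbdd (⟨x, f, hx, rfl⟩ : distRegular x ∈ D)
  linarith

/-- The bound on the localization error, when there are sufficiently many points. -/
theorem localization_of_large {cl cL ce : ℝ} (hcl : 0 < cl) (hcL : 0 ≤ cL) (hce : 0 ≤ ce)
    {n k : ℕ} (hk : 8 ≤ k) (hn : n = 4 * k) {Ω : Type*} [MeasurableSpace Ω] {μ : Measure Ω}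
    [IsProbabilityMeasure μ] {A : Ω → Fin n → Fin n → ℝ} {xstar : Fin n → Circle}
    {fstar : Circle → Circle → ℝ} {S S' : Ω → Finset (Fin n)}
    {loc loc' : (T : Finset (Fin n)) → (T → T → ℝ) → T → Circle} {xhat : Ω → Fin n → Circle}
    (hA : IsObservation μ A) (hstar : IsRepresentation (meanMatrix μ A) cl cL ce xstar fstar)
    (hS : IsSampling k μ A S S') (hloc : IsInitialRule k loc) (hloc' : IsInitialRule k loc')
    (hout : ∀ ω, IsOutput k loc loc' (A ω) (S ω) (S' ω) (xhat ω)) :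
    ∃ G : Set Ω, MeasurableSet G ∧ 1 - 5 / (n : ℝ) ^ 2 ≤ μ.real G ∧ ∀ ω ∈ G, ∀ x f,
      IsRepresentation (meanMatrix μ A) cl cL ce x f → ∃ Q : ℂ ≃ₗᵢ[ℝ] ℂ, ∀ i,
        geoDist (xhat ω i) (orth Q (x i))
          ≤ (33 * refineConst cl cL + 16 + (640 * initConst cl cL + 2)) * (ce + 202)
            * (distRegular x + rate n) := by
  have hn4 : 4 ≤ n := by omega
  have hk0 : 0 < k := by omega
  have hr := rate_pos hn4
  obtain ⟨x₀, f₀, hx₀, hmin⟩ := exists_near_minimal_representation hstar hr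
  obtain ⟨y₀, hy₀, hxy₀⟩ := exists_regular_geoDist_le x₀ hr
  have hδ₀ := distRegular_nonneg x₀
  set τ := distRegular x₀ + (ce + 200) * rate n with hτ
  have hcer : 0 ≤ ce * rate n := mul_nonneg hce hr.le
  have hτ0 : 0 ≤ τ := by rw [hτ]; positivity
  have hslack : slack ce n = ce * rate n := rfl
  -- The term `200 * rate n` in `τ` covers the sampling error 182 plus 1 for the choice of `y₀`, and
  -- separately the grid step (at most 26) and the noise levels 32 and 16.
  have hkτ : 2 * Real.pi / k ≤ τ := by
    have h1 : 2 * Real.pi / k = 8 * Real.pi * (1 / n) := by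
      rw [hn]; push_cast; field_simp; norm_num
    rw [h1]
    have h2 : 8 * Real.pi * (1 / n) ≤ 26 * rate n :=
      mul_le_mul (by linarith [Real.pi_lt_d2]) (inv_le_rate hn4) (by positivity) (by norm_num)
    linarith
  set B₁ := {ω | ¬ WellSampled k y₀ (S ω) (182 * rate n)}
  set B₂ := {ω | ¬ WellSampled k y₀ (S' ω) (182 * rate n)}
  set B₃ := {ω | ∃ s : Finset (Fin n), s.card = k ∧
    ¬ InitialNoiseBound k (fun i j => A ω i j - meanMatrix μ A i j) s τ}
  set B₄ := {ω | ¬ RefineNoiseBound k (fun i j => A ω i j - meanMatrix μ A i j) (S ω)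
    (loc (S ω) (sub (A ω) (S ω))) τ}
  set B₅ := {ω | ¬ RefineNoiseBound k (fun i j => A ω i j - meanMatrix μ A i j) (S' ω)
    (loc' (S' ω) (sub (A ω) (S' ω))) τ}
  set B := B₁ ∪ B₂ ∪ B₃ ∪ B₄ ∪ B₅
  have hB : μ.real B ≤ 5 / (n : ℝ) ^ 2 := by
    have h1 : μ.real B₁ ≤ 1 / (n : ℝ) ^ 3 := prob_not_wellSampled_le hS hk0 hn hy₀
    have h2 : μ.real B₂ ≤ 1 / (n : ℝ) ^ 3 := prob_not_wellSampled_le hS.swap hk0 hn hy₀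
    have h3 : μ.real B₃ ≤ 1 / (n : ℝ) ^ 3 := prob_not_initialNoiseBound_le hA hk0 hn (by linarith)
    have h4 : μ.real B₄ ≤ 1 / (n : ℝ) ^ 3 :=
      prob_not_refineNoiseBound_le hA hS hk0 hn hloc (by linarith)
    have h5 : μ.real B₅ ≤ 1 / (n : ℝ) ^ 3 :=
      prob_not_refineNoiseBound_le hA hS.swap hk0 hn hloc' (by linarith)
    have u1 := measureReal_union_le (μ := μ) (B₁ ∪ B₂ ∪ B₃ ∪ B₄) B₅
    have u2 := measureReal_union_le (μ := μ) (B₁ ∪ B₂ ∪ B₃) B₄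
    have u3 := measureReal_union_le (μ := μ) (B₁ ∪ B₂) B₃
    have u4 := measureReal_union_le (μ := μ) B₁ B₂
    have hn1 : (1 : ℝ) ≤ n := by exact_mod_cast (by omega : 1 ≤ n)
    have h6 : 1 / (n : ℝ) ^ 3 ≤ 1 / (n : ℝ) ^ 2 :=
      one_div_le_one_div_of_le (by positivity) (pow_le_pow_right₀ hn1 (by norm_num))
    have h7 : 5 / (n : ℝ) ^ 2 = 5 * (1 / (n : ℝ) ^ 2) := by ring
    linarith
  -- A measurable hull of `B` has the same measure, so measurability of `B` need not be checked.
  refine ⟨(toMeasurable μ B)ᶜ, (measurableSet_toMeasurable μ B).compl, ?_, fun ω hω x f hx => ?_⟩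
  · rw [probReal_compl_eq_one_sub (measurableSet_toMeasurable μ B), measureReal_def,
      measure_toMeasurable, ← measureReal_def]
    linarith
  · have hωB : ω ∉ B := fun h => hω (subset_toMeasurable μ B h)
    simp only [B, B₁, B₂, B₃, B₄, B₅, Set.mem_union, Set.mem_ofPred_eq, not_or, not_not, not_exists,
      not_and] at hωB
    obtain ⟨⟨⟨⟨g1, g2⟩, g3⟩, g4⟩, g5⟩ := hωB
    have hws : ∀ {s}, WellSampled k y₀ s (182 * rate n) → WellSampled k x₀ s τ := by
      intro s hs
      obtain ⟨v, hv, hvx⟩ := hs.of_close hxy₀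
      exact ⟨v, hv, fun j => (hvx j).trans (by linarith)⟩
    obtain ⟨Q₀, hQ₀⟩ := exists_orth_output hcl hcL hk hn hA.meanMatrix_symm hx₀ hy₀ hτ0
      (by linarith) hkτ (fun i => (hxy₀ i).trans (by linarith)) (hS.card_fst ω) (hS.card_snd ω)
      (hS.disjoint ω) hloc hloc' (hws g1) (hws g2) (g3 _ (hS.card_fst ω)) (g3 _ (hS.card_snd ω))
      g4 g5 (hout ω)
    obtain ⟨y, hy, hxy⟩ := exists_regular_geoDist_le x hr
    have hδ := distRegular_nonneg x
    have hδ₀δ := hmin x f hx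
    -- Near minimality costs one extra `rate n`, so `τ ≤ τ'`, and `τ'` also bounds the distance from
    -- `x₀` to `y₀`.
    set τ' := distRegular x + (ce + 202) * rate n with hτ'
    obtain ⟨Q₁, hQ₁⟩ := exists_orth_of_representations hcl hcL (by omega) hA.meanMatrix_symm hx₀ hx
      hy₀ hy (τ := τ') (by positivity) (by linarith) (fun i => (hxy₀ i).trans (by linarith))
      (fun i => (hxy i).trans (by linarith))
    refine ⟨Q₁.trans Q₀, fun i => ?_⟩
    have hI := initConst_nonneg hcl hcL
    have hR := refineConst_nonneg hcl hcL
    have h1 := geoDist_triangle (xhat ω i) (orth Q₀ (x₀ i)) (orth Q₀ (orth Q₁ (x i)))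
    rw [geoDist_orth] at h1
    have h2 : τ ≤ τ' := by linarith
    have h3 : τ' ≤ (ce + 202) * (distRegular x + rate n) := by
      nlinarith [mul_nonneg hce hδ]
    rw [orth_trans]
    calc _ ≤ (33 * refineConst cl cL + 16) * τ + (640 * initConst cl cL + 2) * τ' :=
          h1.trans (add_le_add (hQ₀ i) (hQ₁ i))
      _ ≤ (33 * refineConst cl cL + 16) * τ' + (640 * initConst cl cL + 2) * τ' := by gcongr
      _ = (33 * refineConst cl cL + 16 + (640 * initConst cl cL + 2)) * τ' := by ring
      _ ≤ (33 * refineConst cl cL + 16 + (640 * initConst cl cL + 2))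
          * ((ce + 202) * (distRegular x + rate n)) := by gcongr
      _ = _ := by ring

end CircleLocalization

theorem corollary3p2 (cl cL ce : ℝ) (hcl : 0 < cl) (hcL : cl ≤ cL) (hce : 0 ≤ ce) :
    ∃ C : ℝ, 0 < C ∧
      ∀ (n₀ n : ℕ), 0 < n₀ → n = 4 * n₀ →
      ∀ (Ω : Type*) [MeasurableSpace Ω] (μ : Measure Ω) [IsProbabilityMeasure μ]
        (A : Ω → Fin n → Fin n → ℝ) (xstar : Fin n → Circle) (fstar : Circle → Circle → ℝ)
        (S S' : Ω → Finset (Fin n))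
        (loc loc' : (T : Finset (Fin n)) → (T → T → ℝ) → T → Circle)
        (xhat : Ω → Fin n → Circle),
        CircleLocalization.IsObservation μ A →
        CircleLocalization.IsRepresentation (CircleLocalization.meanMatrix μ A) cl cL ce
          xstar fstar →
        CircleLocalization.IsSampling n₀ μ A S S' →
        CircleLocalization.IsInitialRule n₀ loc →
        CircleLocalization.IsInitialRule n₀ loc' →
        (∀ ω, CircleLocalization.IsOutput n₀ loc loc' (A ω) (S ω) (S' ω) (xhat ω)) →
        ∃ G : Set Ω, MeasurableSet G ∧ 1 - 5 / (n : ℝ) ^ 2 ≤ μ.real G ∧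
          ∀ ω ∈ G, ∀ (x : Fin n → Circle) (f : Circle → Circle → ℝ),
            CircleLocalization.IsRepresentation (CircleLocalization.meanMatrix μ A) cl cL ce x f →
            ∃ Q : ℂ ≃ₗᵢ[ℝ] ℂ,
              CircleLocalization.dInf (xhat ω) (fun i => CircleLocalization.orth Q (x i))
                ≤ C * (CircleLocalization.distRegular x + Real.sqrt (Real.log n / n)) := by

  have hcL0 : 0 ≤ cL := hcl.le.trans hcL
  have hI := CircleLocalization.initConst_nonneg hcl hcL0
  have hR := CircleLocalization.refineConst_nonneg hcl hcL0
  set C₀ := (33 * CircleLocalization.refineConst cl cL + 16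
    + (640 * CircleLocalization.initConst cl cL + 2)) * (ce + 202) with hC₀
  have hC₀0 : 0 ≤ C₀ := by rw [hC₀]; positivity
  refine ⟨C₀ + 24, by linarith, ?_⟩
  intro k n hk hn Ω _ μ _ A xstar fstar S S' loc loc' xhat hA hstar hS hloc hloc' hout
  have hn4 : 4 ≤ n := by omega
  have hr := CircleLocalization.rate_pos hn4
  -- For `k < 8` the rate is at least `1 / 6`, and the summand 24 in the constant makes the bound
  -- exceed `4 ≥ π`.
  rcases lt_or_ge k 8 with hk8 | hk8
  · refine ⟨Set.univ, MeasurableSet.univ, ?_, fun ω _ x f _ => ⟨LinearIsometryEquiv.refl ℝ ℂ, ?_⟩⟩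
    · rw [probReal_univ]
      have : 0 ≤ 5 / (n : ℝ) ^ 2 := by positivity
      linarith
    · have hδ := CircleLocalization.distRegular_nonneg x
      have h1 := CircleLocalization.rate_ge_of_lt hn4 (by omega)
      refine Real.iSup_le (fun i => (CircleLocalization.geoDist_le_pi _ _).trans ?_) (by positivity)
      have h2 : Real.pi ≤ 4 := Real.pi_le_four
      have h3 : 24 * (1 / 6) ≤ (C₀ + 24) * (CircleLocalization.distRegular x
          + CircleLocalization.rate n) :=
        mul_le_mul (by linarith) (by linarith) (by norm_num) (by linarith)
      exact le_trans (by linarith) h3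
  · obtain ⟨G, hG, hμ, hmain⟩ := CircleLocalization.localization_of_large hcl hcL0 hce hk8 hn hA
      hstar hS hloc hloc' hout
    refine ⟨G, hG, hμ, fun ω hω x f hx => ?_⟩
    obtain ⟨Q, hQ⟩ := hmain ω hω x f hx
    have hδ := CircleLocalization.distRegular_nonneg x
    refine ⟨Q, Real.iSup_le (fun i => (hQ i).trans ?_) (by positivity)⟩
    have h1 : C₀ * (CircleLocalization.distRegular x + CircleLocalization.rate n)
        ≤ (C₀ + 24) * (CircleLocalization.distRegular x + CircleLocalization.rate n) := by
      gcongr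
      linarith
    exact h1
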